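/- Let $N\ge 2$ be an integer and let $\Omega_N=\{x=(x_1,x_2,\dots): x_i\in\mathbb Z/N\mathbb Z,\ x_i\ne 0 \text{ for only finitely many } i\}$ be the hierarchical group of order $N$, with componentwise addition and $|x|=\max\{i: x_i\neq 0\}$ for $x\ne0$, $|0|=0$. Let $(c_j)_{j\ge 0}$ be a nondecreasing sequence of positive numbers with $\sum_j c_jN^{-j}<\infty$, and put $$r_j = D\,\frac{c_{j-1}}{N^{j-1}},\quad j=1,2,\dots,$$ where $D>0$ is the normalizing constant for which $\sum_{j\ge1}r_j=1$. Let $\eta$ have the law $\mathbb P[\eta=y]=\dfrac{r_{|y|}}{N^{|y|-1}(N-1)}$ for $y\neq 0$, $\mathbb P[\eta=0]=0$, and let $p^{(n)}(0,\cdot)$ be the $n$-fold convolution of this law. The continuous-time $(1,(c_j),N)$-random walk $X=\{X(t),t\ge0\}$ is the càdlàg process on the discrete group $\Omega_N$ with stationary independent increments, started at a given point $x_0\in\Omega_N$ (for example $x_0=0$), whose increments over time intervals of length $t$ have the law $$p_t(0,y)=e^{-t}\sum_{n=0}^\infty\frac{t^n}{n!}\,p^{(n)}(0,y),\qquad y\in\Omega_N.$$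 Let $$d_j=c_j\Bigl(\frac N{N-1}+\frac1{c_j}\sum_{k=1}^\infty\frac{c_{j+k}}{N^{k}}\Bigr),\quad j=0,1,2,\dots,$$ and assume that $\sum_j d_j^{-1}=\infty$ (the recurrent case). Then for every function $F:\Omega_N\to[0,\infty)$ that has bounded support (that is, $F(y)=0$ whenever $|y|>R$, for some $R$) and is not identically zero, and for every $x\ge 0$, $$\mathbb P\left[\frac{ND}{(N-1)\,\sum_{y\in\Omega_N}F(y)\,\sum_{0\le j\le \log t/\log N}d_j^{-1}}\int_0^tF(X(s))\,ds<x\right]\longrightarrow 1-e^{-x}\qquad\text{as } t\to\infty .$$ That is, the normalized occupation time converges in law to an exponential random variable with parameter $1$. -/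

import Mathlib

open MeasureTheory ProbabilityTheory Filter Topology Set
open scoped NNReal

/-- The hierarchical group `Ω_N`: the direct sum of countably many copies of `ℤ / N`.
The coordinate `x i`, `i = 0, 1, 2, …`, is the one usually written `x_{i+1}`. -/
def HierGroup (N : ℕ) : Type := ℕ →₀ ZMod N

namespace HierGroup

noncomputable section

variable {N : ℕ}

instance : AddCommGroup (HierGroup N) := inferInstanceAs (AddCommGroup (ℕ →₀ ZMod N))

/-- The group is discrete. -/
instance : TopologicalSpace (HierGroup N) := ⊥

instance : DiscreteTopology (HierGroup N) := ⟨rfl⟩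

/-- Every subset of the countable group is measurable. -/
instance : MeasurableSpace (HierGroup N) := ⊤

/-- `|x| = max {i ≥ 1 : x_i ≠ 0}`, with `|0| = 0`, in the one-based numbering of coordinates.
The hierarchical distance of `x` and `y` is `|x - y|`. -/
def hnorm (x : HierGroup N) : ℕ := (Finsupp.support (M := ZMod N) x).sup (fun i => i + 1)

open Classical in
/-- The law of one jump `η` of an `r_j`-random walk:
`P[η = y] = r_{|y|} / (N^{|y|-1} (N-1))` for `y ≠ 0`, and `P[η = 0] = 0`. -/
def jumpProb (r : ℕ → ℝ) (y : HierGroup N) : ℝ :=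
  if y = 0 then 0 else r (hnorm y) / ((N : ℝ) ^ (hnorm y - 1) * ((N : ℝ) - 1))

open Classical in
/-- The `n`-step transition probability `p^{(n)}(0,y)` of the discrete time `r_j`-random walk,
that is, the `n`-fold convolution of the jump law. -/
def stepProb (r : ℕ → ℝ) : ℕ → HierGroup N → ℝ
  | 0, y => if y = 0 then 1 else 0
  | n + 1, y => ∑' x, stepProb r n x * jumpProb r (y - x)

/-- The transition probability `p_t(0,y) = e^{-t} ∑_n (t^n / n!) p^{(n)}(0,y)` of the continuous
time `r_j`-random walk with unit rate holding times. -/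
def transProb (r : ℕ → ℝ) (t : ℝ) (y : HierGroup N) : ℝ :=
  Real.exp (-t) * ∑' n : ℕ, t ^ n / (n.factorial : ℝ) * stepProb r n y

/-- `X` is a continuous time `r_j`-random walk on `Ω_N` with unit rate holding times, started
at `x₀`: a process with independent stationary increments whose laws are `p_t(0, ·)`, and with
càdlàg paths. -/
structure IsContinuousTimeWalk (r : ℕ → ℝ) (x₀ : HierGroup N)
    {Ω : Type*} [MeasurableSpace Ω] (P : Measure Ω) (X : ℝ≥0 → Ω → HierGroup N) : Prop where
  measurable : ∀ t, Measurable (X t)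
  start : ∀ᵐ ω ∂P, X 0 ω = x₀
  indep : HasIndepIncrements X P
  law : ∀ (s t : ℝ≥0) (y : HierGroup N),
    P.real {ω | X (s + t) ω - X s ω = y} = transProb r t y
  cadlag : ∀ᵐ ω ∂P, ∀ t : ℝ≥0, ContinuousWithinAt (fun s => X s ω) (Ici t) t ∧
    ∃ y, Tendsto (fun s => X s ω) (𝓝[<] t) (𝓝 y)

/-- The jump radius probabilities `r_j = D c_{j-1} / N^{j-1}`, `j ≥ 1`, of the
`(1, (c_j), N)`-random walk. The value at `j = 0` is not used. -/
def radiusProb (N : ℕ) (D : ℝ) (c : ℕ → ℝ) (j : ℕ) : ℝ := D * c (j - 1) / (N : ℝ) ^ (j - 1)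

/-- `d_j = c_j s_{j+1}`, where
`s_{j+1} = N / (N-1) + (1 / c_j) ∑_{k ≥ 1} c_{j+k} / N^k`. -/
def dSeq (N : ℕ) (c : ℕ → ℝ) (j : ℕ) : ℝ :=
  c j * ((N : ℝ) / ((N : ℝ) - 1) + 1 / c j * ∑' k : ℕ, c (j + (k + 1)) / (N : ℝ) ^ (k + 1))

/-- `∑_{0 ≤ j ≤ log t / log N} 1 / d_j` (for `t ≥ 1`). -/
def dSum (N : ℕ) (c : ℕ → ℝ) (t : ℝ) : ℝ :=
  ∑ j ∈ Finset.range (⌊Real.log t / Real.log N⌋₊ + 1), (dSeq N c j)⁻¹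

end

end HierGroup

namespace HierGroup

noncomputable section

variable {N : ℕ}

/-! The proof is the method of moments, fed by an explicit diagonalization of the walk. Let `u_j` be
the uniform density on the ball of radius `j`. The balls are subgroups and the jump law depends only
on the norm, so `u_j - u_{j+1}` is an eigenfunction of convolution with the jump law
(`hasSum_eigenFun_mul_jumpProb`). These functions sum to the point mass at `0`, whence `p_t(0,y) = ∑
exp(-t(1-λ_j)) (u_j - u_{j+1})(y)` (`hasSum_transProb`), with `1 - λ_j = D d_j / N^j`
(`one_sub_eigenVal`).

Integrating at `y = 0` gives `G(T) = (N-1)/(ND) ∑ d_j⁻¹ (1 - exp(-T D d_j / N^j))`. The last factor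
acts as a cutoff at `N^j ≈ T`, so `G(T)` equals `(N-1)/(ND)` times `dSum` up to a bounded error
(`abs_greenZero_sub_le`). On a fixed ball, `p_t(0,y)` lies between `p_t(0,0) - exp(-δt)` and
`p_t(0,0)`, so every point of the ball has the same Green asymptotics.

Let `A_T` be the occupation time. Then `E[A_T^(k+1)] = (k+1) ∫₀ᵀ E[A_u^k F(Y_u)] du`, and by the
Markov property each rate `E[A_s^(k+1) F(Y_s)]` is, up to the two kernel bounds, `(k+1) ∑F` times
the convolution of the previous rate with the kernel (`integral_occRate_succ_bounds`). The integral
of a convolution over `[0,T]` lies between the products of the integrals over `[0,T/2]` and over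
`[0,T]`. Since `dSum` diverges and varies slowly, both bounds agree asymptotically, and the
normalized `k`-th moment tends to `k!` (`tendsto_div_pow_of_recursion`).

The moments are eventually at most `k! 2^k`, so characteristic functions have Taylor expansions with
a uniform radius, and convergence of moments gives convergence in law
(`tendsto_measure_Iio_of_tendsto_moments`). -/

instance [NeZero N] : Countable (HierGroup N) :=
  have : Countable (ZMod N) := Finite.to_countable
  inferInstanceAs (Countable (ℕ →₀ ZMod N))

/-! ### Ultrametric geometry of the hierarchical group. -/

/-- The coordinate with (zero-based) index `i`. -/
def coord (x : HierGroup N) (i : ℕ) : ZMod N := DFunLike.coe (F := ℕ →₀ ZMod N) x i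

lemma hnorm_le_iff {x : HierGroup N} {j : ℕ} :
    hnorm x ≤ j ↔ ∀ i, j ≤ i → x.coord i = 0 := by
  unfold hnorm
  rw [Finset.sup_le_iff]
  constructor
  · intro h i hi
    by_contra hne
    have := h i (Finsupp.mem_support_iff.2 hne)
    omega
  · intro h i hi
    by_contra hlt
    exact Finsupp.mem_support_iff.1 hi (h i (by omega))

lemma hnorm_eq_zero {x : HierGroup N} : hnorm x = 0 ↔ x = 0 := by
  rw [← Nat.le_zero, hnorm_le_iff]
  exact ⟨fun h => Finsupp.ext fun i => h i (Nat.zero_le i), fun h i _ => by rw [h]; rfl⟩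

lemma hnorm_sub_le {x y : HierGroup N} {j : ℕ} (hx : hnorm x ≤ j) (hy : hnorm y ≤ j) :
    hnorm (x - y) ≤ j := by
  rw [hnorm_le_iff] at *
  intro i hi
  have h : (x - y).coord i = x.coord i - y.coord i :=
    Finsupp.sub_apply (G := ZMod N) x y i
  rw [h, hx i hi, hy i hi, sub_zero]

lemma hnorm_sub_le_iff {x y : HierGroup N} {j : ℕ} (hx : hnorm x ≤ j) :
    hnorm (y - x) ≤ j ↔ hnorm y ≤ j := by
  refine ⟨fun h => ?_, fun h => hnorm_sub_le h hx⟩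
  have h0 : hnorm (0 : HierGroup N) ≤ j := by rw [hnorm_eq_zero.2 rfl]; exact Nat.zero_le j
  have := hnorm_sub_le h (hnorm_sub_le h0 hx)
  simpa using this

/-- The ultrametric isosceles property. It makes a radial function constant on each coset of a ball
other than the ball itself. -/
lemma hnorm_sub_eq {x y : HierGroup N} {j : ℕ} (hx : hnorm x ≤ j) (hy : j < hnorm y) :
    hnorm (y - x) = hnorm y :=
  le_antisymm ((hnorm_sub_le_iff (hx.trans hy.le)).2 le_rfl) (by
    by_contra h
    have h1 : hnorm (y - x) ≤ hnorm y - 1 := by omega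
    have := (hnorm_sub_le_iff (y := y) (hx.trans (by omega : j ≤ hnorm y - 1))).1 h1
    omega)

/-- The ball `{y : |y| ≤ j}`, a subgroup of order `N ^ j`. -/
def ball [NeZero N] (j : ℕ) : Finset (HierGroup N) :=
  (Finset.range j).finsupp (fun _ => (Finset.univ : Finset (ZMod N)))

lemma mem_ball [NeZero N] {x : HierGroup N} {j : ℕ} : x ∈ ball j ↔ hnorm x ≤ j := by
  rw [hnorm_le_iff]
  refine Finset.mem_finsupp_iff.trans ⟨fun h i hi => ?_, fun h => ⟨fun i hi => ?_, by simp⟩⟩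
  · by_contra hne
    have := h.1 (Finsupp.mem_support_iff.2 hne)
    rw [Finset.mem_range] at this
    omega
  · rw [Finset.mem_range]
    by_contra hlt
    exact Finsupp.mem_support_iff.1 hi (h i (by omega))

lemma card_ball [NeZero N] (j : ℕ) : (ball (N := N) j).card = N ^ j := by
  have := Finset.card_finsupp (Finset.range j) (fun _ => (Finset.univ : Finset (ZMod N)))
  exact this.trans (by simp [ZMod.card])

lemma ball_subset_ball_succ [NeZero N] (j : ℕ) : ball (N := N) j ⊆ ball (j + 1) := fun _ hx =>
  mem_ball.2 ((mem_ball.1 hx).trans (Nat.le_succ j))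

lemma jumpProb_of_hnorm (r : ℕ → ℝ) {y : HierGroup N} {j : ℕ} (h : hnorm y = j + 1) :
    jumpProb r y = r (j + 1) / ((N : ℝ) ^ j * ((N : ℝ) - 1)) := by
  have hy : y ≠ 0 := fun h0 => by rw [hnorm_eq_zero.2 h0] at h; omega
  rw [jumpProb, if_neg hy, h, Nat.add_sub_cancel]

/-- The sphere of radius `j + 1` has `N^(j+1) - N^j` points, exactly the denominator in the jump
law, so it carries mass `r (j + 1)`. -/
lemma sum_ball_jumpProb [NeZero N] (hN : 2 ≤ N) (r : ℕ → ℝ) (j : ℕ) :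
    ∑ y ∈ ball (N := N) j, jumpProb r y = ∑ i ∈ Finset.range j, r (i + 1) := by
  have hN' : (2 : ℝ) ≤ N := by exact_mod_cast hN
  induction j with
  | zero =>
    rw [Finset.range_zero, Finset.sum_empty]
    refine Finset.sum_eq_zero fun y hy => ?_
    rw [mem_ball, Nat.le_zero, hnorm_eq_zero] at hy
    rw [jumpProb, if_pos hy]
  | succ j ih =>
    classical
    rw [← Finset.sum_sdiff (ball_subset_ball_succ j), ih, Finset.sum_range_succ, add_comm]
    congr 1
    rw [Finset.sum_congr rfl (g := fun _ => r (j + 1) / ((N : ℝ) ^ j * ((N : ℝ) - 1)))]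
    · rw [Finset.sum_const, Finset.card_sdiff_of_subset (ball_subset_ball_succ j), card_ball,
        card_ball, nsmul_eq_mul, Nat.cast_sub (Nat.pow_le_pow_right (by omega) (Nat.le_succ j))]
      push_cast
      have h1 : (N : ℝ) ≠ 0 := by positivity
      have h2 : (N : ℝ) - 1 ≠ 0 := by linarith
      field_simp
      rw [Nat.succ_eq_add_one]
      ring
    · intro y hy
      rw [Finset.mem_sdiff, mem_ball, mem_ball] at hy
      exact jumpProb_of_hnorm r (by omega)

lemma sum_ball_comp_sub [NeZero N] (g : HierGroup N → ℝ) {y : HierGroup N} {j : ℕ}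
    (hy : hnorm y ≤ j) : ∑ x ∈ ball j, g (y - x) = ∑ x ∈ ball j, g x := by
  refine Finset.sum_equiv (Equiv.subLeft y) (fun x => ?_) (fun x _ => rfl)
  rw [mem_ball, mem_ball, Equiv.subLeft_apply]
  refine ⟨fun h => hnorm_sub_le hy h, fun h => ?_⟩
  have := hnorm_sub_le hy h
  simpa using this

/-! ### Spectral decomposition of the step and transition probabilities. -/

/-- The density of the uniform distribution on the ball of radius `j`. -/
def ballDensity (j : ℕ) (y : HierGroup N) : ℝ := if hnorm y ≤ j then ((N : ℝ) ^ j)⁻¹ else 0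

/-- The eigenfunctions of the convolution operators that are invariant under the isometries. -/
def eigenFun (j : ℕ) (y : HierGroup N) : ℝ := ballDensity j y - ballDensity (j + 1) y

/-- The eigenvalue of the jump law at `eigenFun j`. -/
def eigenVal (N : ℕ) (r : ℕ → ℝ) (j : ℕ) : ℝ :=
  ∑ i ∈ Finset.range j, r (i + 1) - r (j + 1) / ((N : ℝ) - 1)

/-- For `y` in the ball, `y - x` runs through the whole ball; for `y` outside, `y - x` always has
the norm of `y`, so averaging over `x` changes nothing. -/
lemma sum_ball_ballDensity_mul_jumpProb [NeZero N] (hN : 2 ≤ N) (r : ℕ → ℝ) (j : ℕ)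
    (y : HierGroup N) :
    ∑ x ∈ ball j, ballDensity j x * jumpProb r (y - x) =
      if hnorm y ≤ j then ((N : ℝ) ^ j)⁻¹ * ∑ i ∈ Finset.range j, r (i + 1) else jumpProb r y := by
  have hN0 : (N : ℝ) ≠ 0 := by positivity
  have h1 : ∑ x ∈ ball j, ballDensity j x * jumpProb r (y - x) =
      ((N : ℝ) ^ j)⁻¹ * ∑ x ∈ ball j, jumpProb r (y - x) := by
    rw [Finset.mul_sum]
    refine Finset.sum_congr rfl fun x hx => ?_
    rw [ballDensity, if_pos (mem_ball.1 hx)]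
  rw [h1]
  split_ifs with h
  · rw [sum_ball_comp_sub (jumpProb r) h, sum_ball_jumpProb hN]
  · push Not at h
    have h2 : ∀ x ∈ ball j, jumpProb r (y - x) = jumpProb r y := fun _ hx => by
      have hy := hnorm_sub_eq (mem_ball.1 hx) h
      rw [jumpProb_of_hnorm r (j := hnorm y - 1) (by omega),
        jumpProb_of_hnorm r (j := hnorm y - 1) (by omega)]
    rw [Finset.sum_congr rfl h2, Finset.sum_const, card_ball, nsmul_eq_mul]
    push_cast
    field_simp

lemma ballDensity_eq_zero [NeZero N] {j : ℕ} {y : HierGroup N} (h : y ∉ ball j) :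
    ballDensity j y = 0 := by
  rw [mem_ball] at h
  rw [ballDensity, if_neg h]

lemma eigenFun_eq_zero [NeZero N] {j : ℕ} {y : HierGroup N} (h : y ∉ ball (j + 1)) :
    eigenFun j y = 0 := by
  rw [eigenFun, ballDensity_eq_zero h, ballDensity_eq_zero fun h' => h (ball_subset_ball_succ j h'),
    sub_zero]

/-- Beyond radius `j + 1` both averages return the jump law and cancel. Within it there are only two
values to compare, on `|y| ≤ j` and on `|y| = j + 1`, and both give the same factor. -/
lemma hasSum_eigenFun_mul_jumpProb [NeZero N] (hN : 2 ≤ N) (r : ℕ → ℝ) (j : ℕ)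
    (y : HierGroup N) :
    HasSum (fun x => eigenFun j x * jumpProb r (y - x)) (eigenVal N r j * eigenFun j y) := by
  have hN' : (2 : ℝ) ≤ N := by exact_mod_cast hN
  have hN0 : (N : ℝ) ≠ 0 := by positivity
  have hN1 : (N : ℝ) - 1 ≠ 0 := by linarith
  have key : ∑ x ∈ ball (j + 1), eigenFun j x * jumpProb r (y - x) =
      eigenVal N r j * eigenFun j y := by
    simp only [eigenFun, sub_mul, Finset.sum_sub_distrib]
    rw [← Finset.sum_subset (ball_subset_ball_succ j)
      (fun x _ hx => by rw [ballDensity_eq_zero hx, zero_mul]),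
      sum_ball_ballDensity_mul_jumpProb hN, sum_ball_ballDensity_mul_jumpProb hN,
      Finset.sum_range_succ]
    unfold ballDensity eigenVal
    generalize ∑ i ∈ Finset.range j, r (i + 1) = R
    rcases lt_trichotomy (hnorm y) (j + 1) with h | h | h
    · rw [if_pos (by omega), if_pos (by omega), if_pos (by omega), if_pos (by omega)]
      field_simp
      ring
    · rw [if_neg (by omega), if_pos (by omega), if_neg (by omega), if_pos (by omega),
        jumpProb_of_hnorm r h]
      field_simp
      ring
    · rw [if_neg (by omega), if_neg (by omega), if_neg (by omega), if_neg (by omega)]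
      ring
  rw [← key]
  exact hasSum_sum_of_ne_finset_zero fun x hx => by rw [eigenFun_eq_zero hx, zero_mul]

lemma jumpProb_nonneg (hN : 2 ≤ N) {r : ℕ → ℝ} (hr : ∀ j, 0 ≤ r (j + 1)) (y : HierGroup N) :
    0 ≤ jumpProb r y := by
  have hN' : (2 : ℝ) ≤ N := by exact_mod_cast hN
  by_cases hy : y = 0
  · rw [jumpProb, if_pos hy]
  · have h : hnorm y ≠ 0 := fun h => hy (hnorm_eq_zero.1 h)
    rw [jumpProb_of_hnorm r (j := hnorm y - 1) (by omega)]
    exact div_nonneg (hr _) (mul_nonneg (by positivity) (by linarith))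

lemma summable_jumpProb [NeZero N] (hN : 2 ≤ N) {r : ℕ → ℝ} (hr : ∀ j, 0 ≤ r (j + 1))
    (hs : HasSum (fun j => r (j + 1)) 1) : Summable (jumpProb (N := N) r) := by
  refine summable_of_sum_le (c := 1) (jumpProb_nonneg hN hr) fun s => ?_
  have hsub : s ⊆ ball (s.sup hnorm) := fun y hy => mem_ball.2 (Finset.le_sup hy)
  refine (Finset.sum_le_sum_of_subset_of_nonneg hsub fun y _ _ => jumpProb_nonneg hN hr y).trans ?_
  rw [sum_ball_jumpProb hN]
  exact sum_le_hasSum _ (fun i _ => hr i) hs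

lemma abs_ballDensity_le (hN : 2 ≤ N) (j : ℕ) (y : HierGroup N) :
    |ballDensity j y| ≤ ((2 : ℝ)⁻¹) ^ j := by
  have hN' : (2 : ℝ) ≤ N := by exact_mod_cast hN
  rw [inv_pow]
  unfold ballDensity
  split_ifs
  · rw [abs_of_nonneg (by positivity)]
    gcongr
  · rw [abs_zero]; positivity

lemma abs_eigenFun_le (hN : 2 ≤ N) (j : ℕ) (y : HierGroup N) :
    |eigenFun j y| ≤ 2 * ((2 : ℝ)⁻¹) ^ j := by
  have h1 := abs_ballDensity_le hN j y
  have h2 := abs_ballDensity_le hN (j + 1) y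
  have h3 : ((2 : ℝ)⁻¹) ^ (j + 1) ≤ ((2 : ℝ)⁻¹) ^ j :=
    pow_le_pow_of_le_one (by norm_num) (by norm_num) (Nat.le_succ j)
  have := abs_sub (ballDensity j y) (ballDensity (j + 1) y)
  unfold eigenFun
  linarith

lemma summable_two_mul_inv_pow : Summable (fun j : ℕ => 2 * ((2 : ℝ)⁻¹) ^ j) :=
  (summable_geometric_of_lt_one (by norm_num) (by norm_num)).mul_left 2

/-- The series telescopes, and `ballDensity 0` is the point mass at the origin: this is the spectral
resolution of the starting law. -/
lemma hasSum_eigenFun (hN : 2 ≤ N) (y : HierGroup N) :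
    HasSum (fun j => eigenFun j y) (ballDensity 0 y) := by
  have hs : Summable (fun j => eigenFun j y) :=
    Summable.of_norm_bounded summable_two_mul_inv_pow fun j => abs_eigenFun_le hN j y
  rw [hs.hasSum_iff_tendsto_nat]
  have h0 : Tendsto (fun j => ballDensity j y) atTop (𝓝 0) :=
    squeeze_zero_norm (fun j => abs_ballDensity_le hN j y)
      (tendsto_pow_atTop_nhds_zero_of_lt_one (by norm_num) (by norm_num))
  have h1 : ∀ n, ∑ j ∈ Finset.range n, eigenFun j y = ballDensity 0 y - ballDensity n y := fun n =>
    Finset.sum_range_sub' (fun j => ballDensity j y) n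
  simp only [h1]
  simpa using h0.const_sub (ballDensity 0 y)

lemma abs_eigenVal_le (hN : 2 ≤ N) {r : ℕ → ℝ} (hr : ∀ j, 0 ≤ r (j + 1))
    (hs : HasSum (fun j => r (j + 1)) 1) (j : ℕ) : |eigenVal N r j| ≤ 1 := by
  have hN' : (2 : ℝ) ≤ N := by exact_mod_cast hN
  have h1 : ∑ i ∈ Finset.range (j + 1), r (i + 1) ≤ 1 := sum_le_hasSum _ (fun i _ => hr i) hs
  have h2 : 0 ≤ ∑ i ∈ Finset.range j, r (i + 1) := Finset.sum_nonneg fun i _ => hr i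
  rw [Finset.sum_range_succ] at h1
  have h3 : 0 ≤ r (j + 1) / ((N : ℝ) - 1) := div_nonneg (hr j) (by linarith)
  have h4 : r (j + 1) / ((N : ℝ) - 1) ≤ r (j + 1) := div_le_self (hr j) (by linarith)
  rw [abs_le]
  unfold eigenVal
  have := hr j
  constructor <;> linarith

/-- Each further convolution multiplies mode `j` by its eigenvalue. The two summations may be
exchanged because `|λ_j| ≤ 1`, the modes are at most `2 · 2⁻ʲ`, and the jump law is summable. -/
lemma hasSum_stepProb [NeZero N] (hN : 2 ≤ N) {r : ℕ → ℝ} (hr : ∀ j, 0 ≤ r (j + 1))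
    (hs : HasSum (fun j => r (j + 1)) 1) (n : ℕ) (y : HierGroup N) :
    HasSum (fun j => eigenVal N r j ^ n * eigenFun j y) (stepProb r n y) := by
  induction n generalizing y with
  | zero =>
    have := hasSum_eigenFun hN y
    simp only [pow_zero, one_mul, stepProb]
    convert! this using 1
    rw [ballDensity]
    by_cases hy : y = 0
    · rw [if_pos hy, if_pos (hnorm_eq_zero.2 hy).le, pow_zero, inv_one]
    · rw [if_neg hy, if_neg fun h => hy (hnorm_eq_zero.1 (Nat.le_zero.1 h))]
  | succ n ih =>
    have hbase : Summable (fun p : ℕ × HierGroup N => (2 * ((2 : ℝ)⁻¹) ^ p.1) * jumpProb r p.2) :=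
      summable_two_mul_inv_pow.mul_of_nonneg (summable_jumpProb hN hr hs)
        (fun j => by positivity) (jumpProb_nonneg hN hr)
    have hbase' : Summable (fun p : ℕ × HierGroup N =>
        (2 * ((2 : ℝ)⁻¹) ^ p.1) * jumpProb r (y - p.2)) :=
      ((Equiv.prodCongr (Equiv.refl ℕ) (Equiv.subLeft y)).summable_iff).2 hbase
    have hsum : Summable (fun p : ℕ × HierGroup N =>
        eigenVal N r p.1 ^ n * eigenFun p.1 p.2 * jumpProb r (y - p.2)) := by
      refine Summable.of_norm_bounded hbase' fun p => ?_
      rw [norm_mul, norm_mul, norm_pow, Real.norm_eq_abs, Real.norm_eq_abs, Real.norm_eq_abs,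
        abs_of_nonneg (jumpProb_nonneg hN hr _)]
      refine mul_le_mul_of_nonneg_right ?_ (jumpProb_nonneg hN hr _)
      refine (mul_le_of_le_one_left (abs_nonneg _) ?_).trans (abs_eigenFun_le hN _ _)
      exact pow_le_one₀ (abs_nonneg _) (abs_eigenVal_le hN hr hs _)
    have h1 : ∀ j, HasSum (fun x => eigenVal N r j ^ n * eigenFun j x * jumpProb r (y - x))
        (eigenVal N r j ^ (n + 1) * eigenFun j y) := fun j => by
      have := (hasSum_eigenFun_mul_jumpProb hN r j y).mul_left (eigenVal N r j ^ n)
      simp only [← mul_assoc, ← pow_succ] at this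
      exact this
    have h2 : HasSum (fun p : ℕ × HierGroup N =>
        eigenVal N r p.1 ^ n * eigenFun p.1 p.2 * jumpProb r (y - p.2)) (stepProb r (n + 1) y) := by
      convert! hsum.hasSum using 1
      rw [← (Equiv.prodComm (HierGroup N) ℕ).tsum_eq]
      have hsum' := (Equiv.prodComm (HierGroup N) ℕ).summable_iff.2 hsum
      refine Eq.trans ?_ hsum'.tsum_prod.symm
      rw [stepProb]
      refine tsum_congr fun x => ?_
      exact ((ih x).mul_right _).tsum_eq.symm
    exact h2.prod_fiberwise h1

lemma hasSum_transProb [NeZero N] (hN : 2 ≤ N) {r : ℕ → ℝ} (hr : ∀ j, 0 ≤ r (j + 1))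
    (hs : HasSum (fun j => r (j + 1)) 1) (t : ℝ) (y : HierGroup N) :
    HasSum (fun j => Real.exp (-(t * (1 - eigenVal N r j))) * eigenFun j y) (transProb r t y) := by
  have hexp : ∀ x : ℝ, HasSum (fun n : ℕ => x ^ n / (n.factorial : ℝ)) (Real.exp x) := fun x => by
    have := NormedSpace.expSeries_div_hasSum_exp (𝔸 := ℝ) x
    rwa [← Real.exp_eq_exp_ℝ] at this
  have hbase : Summable (fun p : ℕ × ℕ =>
      |t| ^ p.1 / (p.1.factorial : ℝ) * (2 * ((2 : ℝ)⁻¹) ^ p.2)) :=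
    (hexp |t|).summable.mul_of_nonneg summable_two_mul_inv_pow (fun n => by positivity)
      (fun j => by positivity)
  have hsum : Summable (fun p : ℕ × ℕ =>
      t ^ p.1 / (p.1.factorial : ℝ) * (eigenVal N r p.2 ^ p.1 * eigenFun p.2 y)) := by
    refine Summable.of_norm_bounded hbase fun p => ?_
    rw [norm_mul, norm_mul, norm_div, norm_pow, norm_pow, Real.norm_natCast]
    simp only [Real.norm_eq_abs]
    refine mul_le_mul_of_nonneg_left ?_ (by positivity)
    refine (mul_le_of_le_one_left (abs_nonneg _) ?_).trans (abs_eigenFun_le hN _ _)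
    exact pow_le_one₀ (abs_nonneg _) (abs_eigenVal_le hN hr hs _)
  have h1 : HasSum (fun p : ℕ × ℕ =>
      t ^ p.1 / (p.1.factorial : ℝ) * (eigenVal N r p.2 ^ p.1 * eigenFun p.2 y))
      (∑' n : ℕ, t ^ n / (n.factorial : ℝ) * stepProb r n y) := by
    convert! hsum.hasSum using 1
    rw [hsum.tsum_prod]
    exact tsum_congr fun n => ((hasSum_stepProb hN hr hs n y).mul_left _).tsum_eq.symm
  have h2 := ((Equiv.prodComm ℕ ℕ).hasSum_iff.2 h1).prod_fiberwise
    (g := fun j => Real.exp (t * eigenVal N r j) * eigenFun j y) (fun j => by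
      have := (hexp (t * eigenVal N r j)).mul_right (eigenFun j y)
      refine this.congr_fun ?_
      intro n
      simp [mul_pow]
      ring)
  have h3 := h2.mul_left (Real.exp (-t))
  refine h3.congr_fun fun j => ?_
  rw [← mul_assoc, ← Real.exp_add]
  congr 2
  ring

/-! ### Comparison of the transition probabilities near the origin. -/

lemma ballDensity_zero_right (j : ℕ) : ballDensity j (0 : HierGroup N) = ((N : ℝ) ^ j)⁻¹ := by
  rw [ballDensity, if_pos (by rw [hnorm_eq_zero.2 rfl]; exact Nat.zero_le j)]

lemma ballDensity_nonneg (j : ℕ) (y : HierGroup N) : 0 ≤ ballDensity j y := by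
  unfold ballDensity
  split_ifs <;> positivity

lemma eigenFun_le_eigenFun_zero (hN : 2 ≤ N) (j : ℕ) (y : HierGroup N) :
    eigenFun j y ≤ eigenFun j (0 : HierGroup N) := by
  have hN' : (2 : ℝ) ≤ N := by exact_mod_cast hN
  unfold eigenFun
  rw [ballDensity_zero_right, ballDensity_zero_right]
  have h1 : ((N : ℝ) ^ (j + 1))⁻¹ ≤ ((N : ℝ) ^ j)⁻¹ := by
    gcongr
    · linarith
    · omega
  unfold ballDensity
  split_ifs
  · exact le_rfl
  · omega
  · have : (0 : ℝ) ≤ ((N : ℝ) ^ (j + 1))⁻¹ := by positivity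
    linarith
  · linarith

lemma eigenFun_zero_nonneg (hN : 2 ≤ N) (j : ℕ) : 0 ≤ eigenFun j (0 : HierGroup N) := by
  have hN' : (2 : ℝ) ≤ N := by exact_mod_cast hN
  unfold eigenFun
  rw [ballDensity_zero_right, ballDensity_zero_right, sub_nonneg]
  gcongr
  · linarith
  · omega

lemma eigenFun_eq_eigenFun_zero {j : ℕ} {y : HierGroup N} (h : hnorm y ≤ j) :
    eigenFun j y = eigenFun j (0 : HierGroup N) := by
  unfold eigenFun
  rw [ballDensity_zero_right, ballDensity_zero_right, ballDensity, ballDensity, if_pos h,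
    if_pos (by omega)]

lemma transProb_le_transProb_zero [NeZero N] (hN : 2 ≤ N) {r : ℕ → ℝ} (hr : ∀ j, 0 ≤ r (j + 1))
    (hs : HasSum (fun j => r (j + 1)) 1) (t : ℝ) (y : HierGroup N) :
    transProb r t y ≤ transProb r t (0 : HierGroup N) :=
  hasSum_le (fun j => mul_le_mul_of_nonneg_left (eigenFun_le_eigenFun_zero hN j y)
    (Real.exp_pos _).le) (hasSum_transProb hN hr hs t y) (hasSum_transProb hN hr hs t 0)

/-- Modes with index at least `R` are constant on the ball of radius `R` and cancel in the
difference. The others decay at rate at least `δ`, and the differences of all modes sum to the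
difference of the point mass at `0` and at `y`, which is at most `1`. -/
lemma transProb_zero_sub_le [NeZero N] (hN : 2 ≤ N) {r : ℕ → ℝ} (hr : ∀ j, 0 ≤ r (j + 1))
    (hs : HasSum (fun j => r (j + 1)) 1) {R : ℕ} {δ : ℝ}
    (hδ : ∀ j < R, δ ≤ 1 - eigenVal N r j) {t : ℝ} (ht : 0 ≤ t) {y : HierGroup N}
    (hy : hnorm y ≤ R) :
    transProb r t (0 : HierGroup N) - Real.exp (-(t * δ)) ≤ transProb r t y := by
  have h1 := (hasSum_transProb hN hr hs t (0 : HierGroup N)).sub (hasSum_transProb hN hr hs t y)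
  have h2 := ((hasSum_eigenFun hN (0 : HierGroup N)).sub (hasSum_eigenFun hN y)).mul_left
    (Real.exp (-(t * δ)))
  have h3 := hasSum_le (fun j => ?_) h1 h2
  · have h4 : ballDensity 0 (0 : HierGroup N) - ballDensity 0 y ≤ 1 := by
      rw [ballDensity_zero_right, pow_zero, inv_one]
      linarith [ballDensity_nonneg 0 y]
    have h5 := mul_le_mul_of_nonneg_left h4 (Real.exp_pos (-(t * δ))).le
    linarith
  · rw [← mul_sub]
    by_cases hj : j < R
    · refine mul_le_mul_of_nonneg_right ?_ (sub_nonneg.2 (eigenFun_le_eigenFun_zero hN j y))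
      exact Real.exp_le_exp.2 (neg_le_neg (mul_le_mul_of_nonneg_left (hδ j hj) ht))
    · rw [eigenFun_eq_eigenFun_zero (by omega : hnorm y ≤ j), sub_self, mul_zero, mul_zero]

/-! ### The return probability and its integral -/

section Return

variable {D : ℝ} {c : ℕ → ℝ}

lemma radiusProb_succ (j : ℕ) : radiusProb N D c (j + 1) = D * c j / (N : ℝ) ^ j := rfl

lemma pos_of_hasSum_radiusProb (hc : ∀ j, 0 < c j)
    (hD : HasSum (fun j : ℕ => radiusProb N D c (j + 1)) 1) : 0 < D := by
  by_contra h
  push Not at h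
  have := hasSum_le (fun j => ?_) hD (hasSum_zero (α := ℝ) (β := ℕ))
  · linarith
  · rw [radiusProb_succ]
    exact div_nonpos_of_nonpos_of_nonneg (mul_nonpos_of_nonpos_of_nonneg h (hc j).le)
      (by positivity)

lemma radiusProb_nonneg (hc : ∀ j, 0 < c j)
    (hD : HasSum (fun j : ℕ => radiusProb N D c (j + 1)) 1) (j : ℕ) :
    0 ≤ radiusProb N D c (j + 1) := by
  rw [radiusProb_succ]
  have h1 := pos_of_hasSum_radiusProb hc hD
  have h2 := hc j
  positivity

lemma dSeq_eq (hc : ∀ j, 0 < c j) (j : ℕ) :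
    dSeq N c j = c j * ((N : ℝ) / ((N : ℝ) - 1)) +
      ∑' k : ℕ, c (j + (k + 1)) / (N : ℝ) ^ (k + 1) := by
  have := (hc j).ne'
  unfold dSeq
  field_simp

/-- Writing `1` as the total of the radius probabilities leaves the tail from `j + 1` on plus
`r_{j+1}/(N-1)`. The two `r_{j+1}` contributions combine to the factor `N/(N-1)` in `d_j`, and the
rest of the tail is the series in `d_j`. -/
lemma one_sub_eigenVal (hN : 2 ≤ N) (hc : ∀ j, 0 < c j)
    (hD : HasSum (fun j : ℕ => radiusProb N D c (j + 1)) 1) (j : ℕ) :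
    1 - eigenVal N (radiusProb N D c) j = D * dSeq N c j / (N : ℝ) ^ j := by
  have hN' : (2 : ℝ) ≤ N := by exact_mod_cast hN
  have hN0 : (N : ℝ) ≠ 0 := by positivity
  have hN1 : (N : ℝ) - 1 ≠ 0 := by linarith
  have hD0 := pos_of_hasSum_radiusProb hc hD
  have h1 := hD.summable.sum_add_tsum_nat_add (j + 1)
  rw [hD.tsum_eq, Finset.sum_range_succ] at h1
  have h2 : ∑' k : ℕ, radiusProb N D c (k + (j + 1) + 1) =
      D / (N : ℝ) ^ j * ∑' k : ℕ, c (j + (k + 1)) / (N : ℝ) ^ (k + 1) := by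
    rw [← tsum_mul_left]
    refine tsum_congr fun k => ?_
    rw [radiusProb_succ, show k + (j + 1) = j + (k + 1) by ring, pow_add]
    field_simp
  rw [h2] at h1
  unfold eigenVal
  rw [radiusProb_succ] at h1
  rw [dSeq_eq hc, radiusProb_succ]
  generalize ∑' k : ℕ, c (j + (k + 1)) / (N : ℝ) ^ (k + 1) = τ at h1 ⊢
  have hS : ∑ i ∈ Finset.range j, radiusProb N D c (i + 1) =
      1 - D * c j / (N : ℝ) ^ j - D / (N : ℝ) ^ j * τ := by linarith
  rw [hS]
  field_simp
  ring

/-- The monotonicity of `c` enters the argument through this uniform lower bound. -/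
lemma le_dSeq (hN : 2 ≤ N) (hc : ∀ j, 0 < c j) (hmono : ∀ j, c j ≤ c (j + 1)) (j : ℕ) :
    c 0 ≤ dSeq N c j := by
  have hN' : (2 : ℝ) ≤ N := by exact_mod_cast hN
  have h1 : c 0 ≤ c j := monotone_nat_of_le_succ hmono (Nat.zero_le j)
  have h2 : 1 ≤ (N : ℝ) / ((N : ℝ) - 1) := by
    rw [le_div_iff₀ (by linarith)]
    linarith
  have h3 : 0 ≤ ∑' k : ℕ, c (j + (k + 1)) / (N : ℝ) ^ (k + 1) :=
    tsum_nonneg fun k => div_nonneg (hc _).le (by positivity)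
  rw [dSeq_eq hc]
  nlinarith [hc j]

lemma hasSum_transProb_zero [NeZero N] (hN : 2 ≤ N) (hc : ∀ j, 0 < c j)
    (hD : HasSum (fun j : ℕ => radiusProb N D c (j + 1)) 1) (t : ℝ) :
    HasSum (fun j => Real.exp (-(t * (D * dSeq N c j / (N : ℝ) ^ j))) *
      (((N : ℝ) ^ j)⁻¹ * (((N : ℝ) - 1) / N)))
      (transProb (radiusProb N D c) t (0 : HierGroup N)) := by
  have hN0 : (N : ℝ) ≠ 0 := by positivity
  refine (hasSum_transProb hN (radiusProb_nonneg hc hD) hD t 0).congr_fun fun j => ?_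
  rw [one_sub_eigenVal hN hc hD, eigenFun, ballDensity_zero_right, ballDensity_zero_right]
  congr 1
  rw [pow_succ]
  field_simp

lemma transProb_zero_mem_Icc [NeZero N] (hN : 2 ≤ N) {r : ℕ → ℝ} (hr : ∀ j, 0 ≤ r (j + 1))
    (hs : HasSum (fun j => r (j + 1)) 1) {t : ℝ} (ht : 0 ≤ t) :
    transProb r t (0 : HierGroup N) ∈ Icc 0 1 := by
  have h := hasSum_transProb hN hr hs t (0 : HierGroup N)
  refine ⟨h.nonneg fun j => mul_nonneg (Real.exp_pos _).le (eigenFun_zero_nonneg hN j), ?_⟩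
  have h1 := hasSum_eigenFun hN (0 : HierGroup N)
  rw [ballDensity_zero_right, pow_zero, inv_one] at h1
  refine hasSum_le (fun j => ?_) h h1
  refine mul_le_of_le_one_left (eigenFun_zero_nonneg hN j) (Real.exp_le_one_iff.2 ?_)
  have := (abs_le.1 (abs_eigenVal_le hN hr hs j)).2
  nlinarith

lemma continuousOn_transProb_zero [NeZero N] (hN : 2 ≤ N) {r : ℕ → ℝ}
    (hr : ∀ j, 0 ≤ r (j + 1)) (hs : HasSum (fun j => r (j + 1)) 1) :
    ContinuousOn (fun t => transProb r t (0 : HierGroup N)) (Ici 0) := by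
  have h : (fun t => transProb r t (0 : HierGroup N)) =
      fun t => ∑' j, Real.exp (-(t * (1 - eigenVal N r j))) * eigenFun j (0 : HierGroup N) :=
    funext fun t => (hasSum_transProb hN hr hs t 0).tsum_eq.symm
  rw [h]
  refine continuousOn_tsum (fun j => by fun_prop) (hasSum_eigenFun hN (0 : HierGroup N)).summable
    fun j t ht => ?_
  rw [norm_mul, Real.norm_of_nonneg (Real.exp_pos _).le,
    Real.norm_of_nonneg (eigenFun_zero_nonneg hN j)]
  refine mul_le_of_le_one_left (eigenFun_zero_nonneg hN j) (Real.exp_le_one_iff.2 ?_)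
  have := (abs_le.1 (abs_eigenVal_le hN hr hs j)).2
  have ht' : (0 : ℝ) ≤ t := ht
  nlinarith

lemma intervalIntegrable_transProb_zero [NeZero N] (hN : 2 ≤ N) {r : ℕ → ℝ}
    (hr : ∀ j, 0 ≤ r (j + 1)) (hs : HasSum (fun j => r (j + 1)) 1) {T : ℝ} (hT : 0 ≤ T) :
    IntervalIntegrable (fun t => transProb r t (0 : HierGroup N)) volume 0 T := by
  refine ContinuousOn.intervalIntegrable ((continuousOn_transProb_zero hN hr hs).mono ?_)
  rw [uIcc_of_le hT]
  exact Icc_subset_Ici_self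

lemma integral_exp_neg_mul {μ : ℝ} (hμ : μ ≠ 0) (T : ℝ) :
    ∫ t in (0 : ℝ)..T, Real.exp (-(t * μ)) = (1 - Real.exp (-(T * μ))) / μ := by
  have h : ∀ t : ℝ, HasDerivAt (fun t => -Real.exp (-(t * μ)) / μ) (Real.exp (-(t * μ))) t := by
    intro t
    have h1 : HasDerivAt (fun t : ℝ => -(t * μ)) (-(1 * μ)) t :=
      ((hasDerivAt_id t).mul_const μ).neg
    convert! (h1.exp.neg.div_const μ) using 1
    field_simp
  rw [intervalIntegral.integral_eq_sub_of_hasDerivAt (fun t _ => h t)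
    (Continuous.intervalIntegrable (by fun_prop) _ _)]
  simp
  ring

/-- The truncated Green function of the walk at the origin. -/
def greenZero (N : ℕ) (D : ℝ) (c : ℕ → ℝ) (T : ℝ) : ℝ :=
  ∫ t in (0 : ℝ)..T, transProb (radiusProb N D c) t (0 : HierGroup N)

lemma hasSum_greenZero [NeZero N] (hN : 2 ≤ N) (hc : ∀ j, 0 < c j)
    (hmono : ∀ j, c j ≤ c (j + 1))
    (hD : HasSum (fun j : ℕ => radiusProb N D c (j + 1)) 1) {T : ℝ} (hT : 0 ≤ T) :
    HasSum (fun j => ((N : ℝ) - 1) / (N * D) * ((dSeq N c j)⁻¹ *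
      (1 - Real.exp (-(T * (D * dSeq N c j / (N : ℝ) ^ j)))))) (greenZero N D c T) := by
  have hN' : (2 : ℝ) ≤ N := by exact_mod_cast hN
  have hN0 : (N : ℝ) ≠ 0 := by positivity
  have hD0 := pos_of_hasSum_radiusProb hc hD
  have hd : ∀ j, 0 < dSeq N c j := fun j => (hc 0).trans_le (le_dSeq hN hc hmono j)
  have h1 := intervalIntegral.hasSum_integral_of_dominated_convergence
    (μ := volume) (a := 0) (b := T)
    (F := fun j t => Real.exp (-(t * (D * dSeq N c j / (N : ℝ) ^ j))) *
      (((N : ℝ) ^ j)⁻¹ * (((N : ℝ) - 1) / N)))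
    (f := fun t => transProb (radiusProb N D c) t (0 : HierGroup N))
    (fun j _ => eigenFun j (0 : HierGroup N))
    (fun j => (Continuous.aestronglyMeasurable (by fun_prop)))
    (fun j => ae_of_all _ fun t ht => ?_)
    (ae_of_all _ fun t ht => (hasSum_eigenFun hN (0 : HierGroup N)).summable)
    (intervalIntegrable_const)
    (ae_of_all _ fun t ht => hasSum_transProb_zero hN hc hD t)
  · refine h1.congr_fun fun j => ?_
    rw [intervalIntegral.integral_mul_const, integral_exp_neg_mul]
    · have := (hd j).ne'
      field_simp
    · have := hd j
      positivity
  · have h2 : eigenFun j (0 : HierGroup N) = ((N : ℝ) ^ j)⁻¹ * (((N : ℝ) - 1) / N) := by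
      rw [eigenFun, ballDensity_zero_right, ballDensity_zero_right, pow_succ]
      field_simp
    have h3 := eigenFun_zero_nonneg hN j
    rw [← h2, norm_mul, Real.norm_of_nonneg (Real.exp_pos _).le, Real.norm_of_nonneg h3]
    refine mul_le_of_le_one_left h3 (Real.exp_le_one_iff.2 ?_)
    rw [uIoc_of_le hT] at ht
    have := hd j
    have := ht.1.le
    rw [neg_nonpos]
    positivity

lemma pow_floor_log_div_log (hN : 2 ≤ N) {T : ℝ} (hT : 1 ≤ T) :
    (N : ℝ) ^ ⌊Real.log T / Real.log N⌋₊ ≤ T ∧ T ≤ (N : ℝ) ^ (⌊Real.log T / Real.log N⌋₊ + 1) := by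
  have hN' : (2 : ℝ) ≤ N := by exact_mod_cast hN
  have hlog : 0 < Real.log N := Real.log_pos (by linarith)
  have hT0 : 0 < T := by linarith
  constructor
  · have h := Nat.floor_le (div_nonneg (Real.log_nonneg hT) hlog.le)
    rw [le_div_iff₀ hlog, ← Real.log_pow] at h
    exact (Real.log_le_log_iff (by positivity) hT0).1 h
  · have h := (Nat.lt_floor_add_one (Real.log T / Real.log N)).le
    rw [div_le_iff₀ hlog] at h
    refine (Real.log_le_log_iff hT0 (by positivity)).1 ?_
    rw [Real.log_pow]
    exact_mod_cast h

/-- With `x_j = T D d_j / N^j`, beyond the cutoff `1 - exp(-x_j) ≤ x_j` cancels `d_j⁻¹` and leaves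
`D T / N^j`. Up to the cutoff the defect `exp(-x_j) ≤ 1/x_j` is of order `N^j / T`. Both are
geometric series in the distance from the cutoff. -/
lemma abs_greenZero_sub_le [NeZero N] (hN : 2 ≤ N) (hc : ∀ j, 0 < c j)
    (hmono : ∀ j, c j ≤ c (j + 1))
    (hD : HasSum (fun j : ℕ => radiusProb N D c (j + 1)) 1) :
    ∃ C : ℝ, ∀ T : ℝ, 1 ≤ T →
      |greenZero N D c T - ((N : ℝ) - 1) / (N * D) * dSum N c T| ≤ C := by
  have hN' : (2 : ℝ) ≤ N := by exact_mod_cast hN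
  have hN0 : (N : ℝ) ≠ 0 := by positivity
  have hD0 := pos_of_hasSum_radiusProb hc hD
  have hc0 := hc 0
  have hdc : ∀ j, c 0 ≤ dSeq N c j := le_dSeq hN hc hmono
  have hd : ∀ j, 0 < dSeq N c j := fun j => hc0.trans_le (hdc j)
  have hκ : 0 ≤ ((N : ℝ) - 1) / (N * D) := div_nonneg (by linarith) (by positivity)
  -- The first summand bounds the terms up to the cutoff, the second those beyond it; each `2` is
  -- the sum of the geometric series of ratio `1/2`, which dominates ratio `1/N`.
  refine ⟨((N : ℝ) - 1) / (N * D) * (2 * (c 0 * D * c 0)⁻¹ + 2 * D), fun T hT => ?_⟩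
  have hT0 : 0 < T := by linarith
  have hsum := hasSum_greenZero hN hc hmono hD hT0.le
  obtain ⟨hJ1, hJ2⟩ := pow_floor_log_div_log hN hT
  rw [dSum]
  set J := ⌊Real.log T / Real.log N⌋₊ with hJ
  have hsplit := hsum.summable.sum_add_tsum_nat_add (J + 1)
  rw [hsum.tsum_eq, ← Finset.mul_sum, tsum_mul_left] at hsplit
  rw [← hsplit, ← mul_add, ← mul_sub, abs_mul, abs_of_nonneg hκ]
  refine mul_le_mul_of_nonneg_left ?_ hκ
  have hgeom : HasSum (fun i : ℕ => ((2 : ℝ)⁻¹) ^ i) 2 := by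
    have := hasSum_geometric_of_lt_one (r := (2 : ℝ)⁻¹) (by norm_num) (by norm_num)
    convert! this using 1
    norm_num
  -- the terms beyond the cutoff
  have htail0 : ∀ k, 0 ≤ (dSeq N c (k + (J + 1)))⁻¹ *
      (1 - Real.exp (-(T * (D * dSeq N c (k + (J + 1)) / (N : ℝ) ^ (k + (J + 1)))))) := fun k => by
    have h1 := hd (k + (J + 1))
    refine mul_nonneg (by positivity) (sub_nonneg.2 (Real.exp_le_one_iff.2 (neg_nonpos.2 ?_)))
    positivity
  have htail1 : ∀ k, (dSeq N c (k + (J + 1)))⁻¹ *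
      (1 - Real.exp (-(T * (D * dSeq N c (k + (J + 1)) / (N : ℝ) ^ (k + (J + 1)))))) ≤
      D * ((2 : ℝ)⁻¹) ^ k := fun k => by
    have h1 := hd (k + (J + 1))
    have h2 := Real.one_sub_le_exp_neg (T * (D * dSeq N c (k + (J + 1)) / (N : ℝ) ^ (k + (J + 1))))
    calc _ ≤ (dSeq N c (k + (J + 1)))⁻¹ *
        (T * (D * dSeq N c (k + (J + 1)) / (N : ℝ) ^ (k + (J + 1)))) := by
          refine mul_le_mul_of_nonneg_left ?_ (by positivity)
          linarith
      _ = D * (T / (N : ℝ) ^ (J + 1)) * ((N : ℝ)⁻¹) ^ k := by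
          rw [pow_add, inv_pow]
          field_simp
      _ ≤ D * 1 * ((2 : ℝ)⁻¹) ^ k := by
          gcongr
          rw [div_le_one (by positivity)]
          exact hJ2
      _ = D * ((2 : ℝ)⁻¹) ^ k := by ring
  have hts : Summable fun k => (dSeq N c (k + (J + 1)))⁻¹ *
      (1 - Real.exp (-(T * (D * dSeq N c (k + (J + 1)) / (N : ℝ) ^ (k + (J + 1)))))) :=
    Summable.of_nonneg_of_le htail0 htail1 (hgeom.summable.mul_left D)
  have htail2 := tsum_nonneg (L := .unconditional ℕ) htail0
  have htail3 := hts.tsum_le_tsum htail1 (hgeom.summable.mul_left D)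
  rw [tsum_mul_left, hgeom.tsum_eq] at htail3
  -- the terms up to the cutoff
  have hhead : ∑ j ∈ Finset.range (J + 1), (dSeq N c j)⁻¹ - ∑ j ∈ Finset.range (J + 1),
      (dSeq N c j)⁻¹ * (1 - Real.exp (-(T * (D * dSeq N c j / (N : ℝ) ^ j)))) =
      ∑ j ∈ Finset.range (J + 1), (dSeq N c j)⁻¹ *
        Real.exp (-(T * (D * dSeq N c j / (N : ℝ) ^ j))) := by
    rw [← Finset.sum_sub_distrib]
    refine Finset.sum_congr rfl fun j _ => by ring
  have hhead0 : 0 ≤ ∑ j ∈ Finset.range (J + 1), (dSeq N c j)⁻¹ *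
        Real.exp (-(T * (D * dSeq N c j / (N : ℝ) ^ j))) := Finset.sum_nonneg fun j _ => by
    have := hd j
    positivity
  have hhead1 : ∑ j ∈ Finset.range (J + 1), (dSeq N c j)⁻¹ *
        Real.exp (-(T * (D * dSeq N c j / (N : ℝ) ^ j))) ≤ 2 * (c 0 * D * c 0)⁻¹ := by
    -- Counting by the distance `i = J - j` back from the cutoff turns `N^j / N^J` into `N⁻ⁱ`.
    rw [← Finset.sum_range_reflect]
    calc _ ≤ ∑ i ∈ Finset.range (J + 1), ((2 : ℝ)⁻¹) ^ i * (c 0 * D * c 0)⁻¹ := by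
          refine Finset.sum_le_sum fun i hi => ?_
          rw [Finset.mem_range] at hi
          have hj : J + 1 - 1 - i + i = J := by omega
          set j := J + 1 - 1 - i
          have h1 := hd j
          have h2 : Real.exp (-(T * (D * dSeq N c j / (N : ℝ) ^ j))) ≤
              (T * (D * dSeq N c j / (N : ℝ) ^ j))⁻¹ := by
            rw [Real.exp_neg]
            gcongr
            have := Real.add_one_le_exp (T * (D * dSeq N c j / (N : ℝ) ^ j))
            linarith
          calc _ ≤ (c 0)⁻¹ * (T * (D * c 0 / (N : ℝ) ^ j))⁻¹ := by
                refine mul_le_mul (inv_anti₀ hc0 (hdc j)) (h2.trans ?_) (by positivity)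
                  (by positivity)
                gcongr
                exact hdc j
            _ = (N : ℝ) ^ j / T * (c 0 * D * c 0)⁻¹ := by field_simp
            _ ≤ (N : ℝ) ^ j / (N : ℝ) ^ J * (c 0 * D * c 0)⁻¹ := by gcongr
            _ = ((N : ℝ)⁻¹) ^ i * (c 0 * D * c 0)⁻¹ := by
                rw [← hj, pow_add, inv_pow]
                field_simp
            _ ≤ _ := by gcongr
      _ = (∑ i ∈ Finset.range (J + 1), ((2 : ℝ)⁻¹) ^ i) * (c 0 * D * c 0)⁻¹ := by
          rw [Finset.sum_mul]
      _ ≤ _ := by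
          gcongr
          exact sum_le_hasSum _ (fun i _ => by positivity) hgeom
  rw [abs_le]
  constructor
  · have : 0 ≤ (c 0 * D * c 0)⁻¹ := by positivity
    linarith
  · have : 0 ≤ (c 0 * D * c 0)⁻¹ := by positivity
    linarith

lemma tendsto_dSum (hN : 2 ≤ N) (hc : ∀ j, 0 < c j) (hmono : ∀ j, c j ≤ c (j + 1))
    (hrec : ¬ Summable (fun j : ℕ => (dSeq N c j)⁻¹)) : Tendsto (dSum N c) atTop atTop := by
  have hN' : (2 : ℝ) ≤ N := by exact_mod_cast hN
  have h0 : ∀ j, 0 ≤ (dSeq N c j)⁻¹ := fun j =>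
    inv_nonneg.2 ((hc 0).trans_le (le_dSeq hN hc hmono j)).le
  have h1 := (not_summable_iff_tendsto_nat_atTop_of_nonneg h0).1 hrec
  refine h1.comp ((tendsto_add_atTop_nat 1).comp (tendsto_nat_floor_atTop.comp ?_))
  exact Real.tendsto_log_atTop.atTop_div_const (Real.log_pos (by linarith))

/-- Since `N ≥ 2`, halving `T` lowers `log T / log N` by at most `1`, so at most one term is lost,
and it is at most `1 / c 0`. This is the slow variation of `dSum`. -/
lemma dSum_half_bounds (hN : 2 ≤ N) (hc : ∀ j, 0 < c j) (hmono : ∀ j, c j ≤ c (j + 1))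
    {T : ℝ} (hT : 2 ≤ T) :
    dSum N c T - (c 0)⁻¹ ≤ dSum N c (T / 2) ∧ dSum N c (T / 2) ≤ dSum N c T := by
  have hN' : (2 : ℝ) ≤ N := by exact_mod_cast hN
  have hlog : 0 < Real.log N := Real.log_pos (by linarith)
  have hd := le_dSeq hN hc hmono
  have h0 : ∀ j, 0 ≤ (dSeq N c j)⁻¹ := fun j => inv_nonneg.2 ((hc 0).trans_le (hd j)).le
  have hle : ⌊Real.log (T / 2) / Real.log N⌋₊ ≤ ⌊Real.log T / Real.log N⌋₊ := by
    gcongr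
    linarith
  have hge : ⌊Real.log T / Real.log N⌋₊ ≤ ⌊Real.log (T / 2) / Real.log N⌋₊ + 1 := by
    have h2 : Real.log T / Real.log N ≤ Real.log (T / 2) / Real.log N + 1 := by
      rw [Real.log_div (by linarith) (by norm_num), div_add_one hlog.ne']
      gcongr
      have := Real.log_le_log (by norm_num) hN'
      linarith
    rw [← Nat.floor_add_one (div_nonneg (Real.log_nonneg (by linarith)) hlog.le)]
    gcongr
  unfold dSum
  refine ⟨?_, Finset.sum_le_sum_of_subset_of_nonneg
    (Finset.range_mono (by omega)) fun j _ _ => h0 j⟩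
  have h3 : ∑ j ∈ Finset.range (⌊Real.log T / Real.log N⌋₊ + 1), (dSeq N c j)⁻¹ ≤
      ∑ j ∈ Finset.range (⌊Real.log (T / 2) / Real.log N⌋₊ + 1 + 1), (dSeq N c j)⁻¹ :=
    Finset.sum_le_sum_of_subset_of_nonneg (Finset.range_mono (by omega)) fun j _ _ => h0 j
  rw [Finset.sum_range_succ _ (⌊Real.log (T / 2) / Real.log N⌋₊ + 1)] at h3
  have h4 := inv_anti₀ (hc 0) (hd (⌊Real.log (T / 2) / Real.log N⌋₊ + 1))
  linarith

lemma tendsto_div_of_abs_sub_le {f g : ℝ → ℝ} {a C T₀ : ℝ} (hg : Tendsto g atTop atTop)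
    (h : ∀ T, T₀ ≤ T → |f T - a * g T| ≤ C) : Tendsto (fun T => f T / g T) atTop (𝓝 a) := by
  have h1 : Tendsto (fun T => (f T - a * g T) / g T) atTop (𝓝 0) := by
    refine squeeze_zero_norm' ?_ (hg.const_div_atTop C)
    filter_upwards [eventually_ge_atTop T₀, hg.eventually_gt_atTop 0] with T hT hT'
    rw [norm_div, Real.norm_eq_abs, Real.norm_of_nonneg hT'.le]
    gcongr
    exact h T hT
  have h2 := h1.add_const a
  rw [zero_add] at h2
  refine h2.congr' ?_
  filter_upwards [hg.eventually_gt_atTop 0] with T hT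
  field_simp
  ring

lemma tendsto_dSum_half (hN : 2 ≤ N) (hc : ∀ j, 0 < c j) (hmono : ∀ j, c j ≤ c (j + 1))
    (hrec : ¬ Summable (fun j : ℕ => (dSeq N c j)⁻¹)) :
    Tendsto (fun T => dSum N c (T / 2) / dSum N c T) atTop (𝓝 1) := by
  refine tendsto_div_of_abs_sub_le (C := (c 0)⁻¹) (T₀ := 2) (tendsto_dSum hN hc hmono hrec)
    fun T hT => ?_
  have := dSum_half_bounds hN hc hmono hT
  have h0 : 0 ≤ (c 0)⁻¹ := inv_nonneg.2 (hc 0).le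
  rw [abs_le]
  constructor <;> linarith

lemma tendsto_greenZero_div_dSum [NeZero N] (hN : 2 ≤ N) (hc : ∀ j, 0 < c j)
    (hmono : ∀ j, c j ≤ c (j + 1)) (hD : HasSum (fun j : ℕ => radiusProb N D c (j + 1)) 1)
    (hrec : ¬ Summable (fun j : ℕ => (dSeq N c j)⁻¹)) :
    Tendsto (fun T => greenZero N D c T / dSum N c T) atTop (𝓝 (((N : ℝ) - 1) / (N * D))) := by
  obtain ⟨C, hC⟩ := abs_greenZero_sub_le hN hc hmono hD
  exact tendsto_div_of_abs_sub_le (tendsto_dSum hN hc hmono hrec) hC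

/-- A lower bound of the transition probabilities near the origin. -/
def lowerKernel (N : ℕ) (r : ℕ → ℝ) (δ t : ℝ) : ℝ :=
  max 0 (transProb r t (0 : HierGroup N) - Real.exp (-(t * δ)))

lemma continuousOn_lowerKernel [NeZero N] (hN : 2 ≤ N) {r : ℕ → ℝ}
    (hr : ∀ j, 0 ≤ r (j + 1)) (hs : HasSum (fun j => r (j + 1)) 1) (δ : ℝ) :
    ContinuousOn (lowerKernel N r δ) (Ici 0) :=
  ContinuousOn.sup continuousOn_const
    ((continuousOn_transProb_zero hN hr hs).sub (Continuous.continuousOn (by fun_prop)))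

/-- The subtracted exponential has integral at most `1/δ`, which is negligible against the divergent
`dSum`. -/
lemma tendsto_integral_lowerKernel_div_dSum [NeZero N] (hN : 2 ≤ N) (hc : ∀ j, 0 < c j)
    (hmono : ∀ j, c j ≤ c (j + 1)) (hD : HasSum (fun j : ℕ => radiusProb N D c (j + 1)) 1)
    (hrec : ¬ Summable (fun j : ℕ => (dSeq N c j)⁻¹)) {δ : ℝ} (hδ : 0 < δ) :
    Tendsto (fun T => (∫ t in (0 : ℝ)..T, lowerKernel N (radiusProb N D c) δ t) / dSum N c T)
      atTop (𝓝 (((N : ℝ) - 1) / (N * D))) := by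
  obtain ⟨C, hC⟩ := abs_greenZero_sub_le hN hc hmono hD
  have hr := radiusProb_nonneg hc hD
  refine tendsto_div_of_abs_sub_le (C := C + δ⁻¹) (T₀ := 1) (tendsto_dSum hN hc hmono hrec)
    fun T hT => ?_
  have hT0 : (0 : ℝ) ≤ T := by linarith
  have hint := intervalIntegrable_transProb_zero hN hr hD hT0
  have hexp : IntervalIntegrable (fun t : ℝ => Real.exp (-(t * δ))) volume 0 T :=
    Continuous.intervalIntegrable (by fun_prop) _ _
  have hlow : IntervalIntegrable (lowerKernel N (radiusProb N D c) δ) volume 0 T := by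
    refine ContinuousOn.intervalIntegrable ((continuousOn_lowerKernel hN hr hD δ).mono ?_)
    rw [uIcc_of_le hT0]
    exact Icc_subset_Ici_self
  have h1 : ∫ t in (0 : ℝ)..T, lowerKernel N (radiusProb N D c) δ t ≤ greenZero N D c T :=
    intervalIntegral.integral_mono_on hT0 hlow hint fun t ht =>
      max_le (transProb_zero_mem_Icc hN hr hD ht.1).1 (sub_le_self _ (Real.exp_pos _).le)
  have h2 : ∫ t in (0 : ℝ)..T, (transProb (radiusProb N D c) t (0 : HierGroup N) -
      Real.exp (-(t * δ))) ≤ ∫ t in (0 : ℝ)..T, lowerKernel N (radiusProb N D c) δ t :=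
    intervalIntegral.integral_mono_on hT0 (hint.sub hexp) hlow fun t _ => le_max_right _ _
  rw [intervalIntegral.integral_sub hint hexp, integral_exp_neg_mul hδ.ne'] at h2
  have h3 : (1 - Real.exp (-(T * δ))) / δ ≤ δ⁻¹ := by
    rw [← one_div]
    gcongr
    linarith [Real.exp_pos (-(T * δ))]
  have h4 := abs_le.1 (hC T hT)
  have h5 : 0 < δ⁻¹ := inv_pos.2 hδ
  unfold greenZero at h1 h4
  rw [abs_le]
  constructor <;> linarith

lemma exists_pos_le_one_sub_eigenVal (hN : 2 ≤ N) (hc : ∀ j, 0 < c j)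
    (hmono : ∀ j, c j ≤ c (j + 1)) (hD : HasSum (fun j : ℕ => radiusProb N D c (j + 1)) 1)
    (R : ℕ) : ∃ δ : ℝ, 0 < δ ∧ ∀ j < R, δ ≤ 1 - eigenVal N (radiusProb N D c) j := by
  have hD0 := pos_of_hasSum_radiusProb hc hD
  have hN' : (2 : ℝ) ≤ N := by exact_mod_cast hN
  have hc0 := hc 0
  refine ⟨D * c 0 / (N : ℝ) ^ R, by positivity, fun j hj => ?_⟩
  rw [one_sub_eigenVal hN hc hD]
  have h := le_dSeq hN hc hmono j
  have h' := hc0.trans_le h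
  gcongr
  linarith

end Return

/-! ### Convergence to the exponential law by moments -/

lemma ae_nonneg_expMeasure : ∀ᵐ x ∂(expMeasure 1), 0 ≤ x := by
  have h : (expMeasure 1) (Iio 0) = 0 := by
    rw [expMeasure, gammaMeasure, withDensity_apply _ measurableSet_Iio]
    exact lintegral_gammaPDF_of_nonpos le_rfl
  rw [ae_iff]
  simpa [Iio_def] using h

lemma gammaPDF_one_one_smul (k : ℕ) :
    (fun x : ℝ => (gammaPDF 1 1 x).toReal • x ^ k) =
      (Ici (0 : ℝ)).indicator (fun x => Real.exp (-x) * x ^ k) := by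
  funext x
  rw [gammaPDF, ENNReal.toReal_ofReal (gammaPDFReal_nonneg one_pos one_pos x), gammaPDFReal,
    indicator_apply]
  simp only [mem_Ici]
  split_ifs <;> simp

lemma measurable_gammaPDF_one_one : Measurable (gammaPDF 1 1) :=
  (measurable_gammaPDFReal 1 1).ennreal_ofReal

lemma integrable_pow_expMeasure (k : ℕ) : Integrable (fun x : ℝ => x ^ k) (expMeasure 1) := by
  rw [expMeasure, gammaMeasure, integrable_withDensity_iff_integrable_smul'
    measurable_gammaPDF_one_one (ae_of_all _ fun x => ENNReal.ofReal_lt_top),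
    gammaPDF_one_one_smul, integrable_indicator_iff measurableSet_Ici,
    integrableOn_Ici_iff_integrableOn_Ioi]
  have h := Real.GammaIntegral_convergent (s := k + 1) (by positivity)
  simpa using h

lemma integral_pow_expMeasure (k : ℕ) : ∫ x : ℝ, x ^ k ∂(expMeasure 1) = k.factorial := by
  rw [expMeasure, gammaMeasure, integral_withDensity_eq_integral_toReal_smul
    measurable_gammaPDF_one_one (ae_of_all _ fun x => ENNReal.ofReal_lt_top),
    gammaPDF_one_one_smul, integral_indicator measurableSet_Ici, integral_Ici_eq_integral_Ioi,
    ← Real.Gamma_nat_eq_factorial, Real.Gamma_eq_integral (by positivity)]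
  simp

/-- The derivatives of the characteristic function of `μ`, up to powers of `i`. -/
def charMoment (μ : Measure ℝ) (k : ℕ) (t : ℝ) : ℂ :=
  ∫ x, (x : ℂ) ^ k * Complex.exp (t * x * Complex.I) ∂μ

/-- The measure `μ` is carried by `[0, ∞)`, and its moments grow no faster than those of an
exponential law of mean `2`. -/
structure HasExpMoments (μ : Measure ℝ) : Prop where
  nonneg : ∀ᵐ x ∂μ, 0 ≤ x
  integrable : ∀ k : ℕ, Integrable (fun x : ℝ => x ^ k) μ
  le : ∀ k : ℕ, ∫ x : ℝ, x ^ k ∂μ ≤ k.factorial * 2 ^ k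

lemma norm_charMoment_integrand (k : ℕ) (t x : ℝ) :
    ‖(x : ℂ) ^ k * Complex.exp (t * x * Complex.I)‖ = |x| ^ k := by
  rw [norm_mul, norm_pow, Complex.norm_real, ← Complex.ofReal_mul, Complex.norm_exp_ofReal_mul_I,
    mul_one, Real.norm_eq_abs]

lemma integrable_charMoment_integrand {μ : Measure ℝ} (hμ : HasExpMoments μ) (k : ℕ) (t : ℝ) :
    Integrable (fun x : ℝ => (x : ℂ) ^ k * Complex.exp (t * x * Complex.I)) μ := by
  refine (hμ.integrable k).mono (Continuous.aestronglyMeasurable (by fun_prop))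
    (ae_of_all _ fun x => ?_)
  rw [norm_charMoment_integrand, norm_pow, Real.norm_eq_abs]

lemma integral_norm_charMoment_integrand_le {μ : Measure ℝ} (hμ : HasExpMoments μ) (k : ℕ)
    (t : ℝ) :
    ∫ x : ℝ, ‖(x : ℂ) ^ k * Complex.exp (t * x * Complex.I)‖ ∂μ ≤ k.factorial * 2 ^ k := by
  refine le_trans (le_of_eq (integral_congr_ae ?_)) (hμ.le k)
  filter_upwards [hμ.nonneg] with x hx
  rw [norm_charMoment_integrand, abs_of_nonneg hx]

lemma norm_charMoment_le {μ : Measure ℝ} (hμ : HasExpMoments μ) (k : ℕ) (t : ℝ) :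
    ‖charMoment μ k t‖ ≤ k.factorial * 2 ^ k :=
  (norm_integral_le_integral_norm _).trans (integral_norm_charMoment_integrand_le hμ k t)

/-- Moments of size `k! 2^k` allow Taylor steps shorter than `1/2`. A step of at most `1/4` leaves
the ratio `1/2` against a binomial coefficient of fixed lower index, which is summable. -/
lemma taylorBound_le {h : ℝ} (hh : |h| ≤ 4⁻¹) (k j : ℕ) :
    |h| ^ j / (j.factorial : ℝ) * ((k + j).factorial * 2 ^ (k + j)) ≤
      (k.factorial * 2 ^ k) * (((j + k).choose k : ℝ) * (2⁻¹) ^ j) := by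
  have h1 : ((k + j).factorial : ℝ) = (j + k).choose k * j.factorial * k.factorial := by
    rw [add_comm k j, ← Nat.add_choose_mul_factorial_mul_factorial j k, add_comm j k,
      Nat.choose_symm_add]
    push_cast
    rw [add_comm k j]
  have h2 : (0 : ℝ) < j.factorial := by exact_mod_cast j.factorial_pos
  have h3 : |h| ^ j ≤ (4⁻¹ : ℝ) ^ j := pow_le_pow_left₀ (abs_nonneg h) hh j
  calc _ = (k.factorial * 2 ^ k) * (((j + k).choose k : ℝ) * (|h| ^ j * 2 ^ j)) := by
        rw [h1, pow_add]
        field_simp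
    _ ≤ (k.factorial * 2 ^ k) * (((j + k).choose k : ℝ) * ((4⁻¹ : ℝ) ^ j * 2 ^ j)) := by gcongr
    _ = _ := by rw [← mul_pow]; norm_num

lemma summable_taylorBound (k : ℕ) : Summable (fun j : ℕ =>
    ((k.factorial : ℝ) * 2 ^ k) * (((j + k).choose k : ℝ) * (2⁻¹) ^ j)) :=
  (summable_choose_mul_geometric_of_norm_lt_one k (r := (2⁻¹ : ℝ)) (by norm_num)).mul_left _

/-- Expansion of `exp(ihx)` under the integral sign. The admissible step depends neither on the base
point `t` nor on the measure. -/
lemma hasSum_charMoment {μ : Measure ℝ} (hμ : HasExpMoments μ) {h : ℝ} (hh : |h| ≤ 4⁻¹) (k : ℕ)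
    (t : ℝ) :
    HasSum (fun j : ℕ => (h * Complex.I) ^ j / (j.factorial : ℂ) * charMoment μ (k + j) t)
      (charMoment μ k (t + h)) := by
  have h1 := hasSum_integral_of_summable_integral_norm (μ := μ)
    (F := fun (j : ℕ) (x : ℝ) => (h * Complex.I) ^ j / (j.factorial : ℂ) *
      ((x : ℂ) ^ (k + j) * Complex.exp (t * x * Complex.I)))
    (fun j => (integrable_charMoment_integrand hμ (k + j) t).const_mul _) ?_
  · have h2 : charMoment μ k (t + h) = ∫ x : ℝ, ∑' j : ℕ, (h * Complex.I) ^ j / (j.factorial : ℂ) *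
      ((x : ℂ) ^ (k + j) * Complex.exp (t * x * Complex.I)) ∂μ := by
      refine integral_congr_ae (ae_of_all _ fun x => ?_)
      have h3 := (NormedSpace.expSeries_div_hasSum_exp (𝔸 := ℂ) (h * x * Complex.I)).mul_left
        ((x : ℂ) ^ k * Complex.exp (t * x * Complex.I))
      rw [← Complex.exp_eq_exp_ℂ, mul_assoc ((x : ℂ) ^ k), ← Complex.exp_add] at h3
      have h4 : (t * x * Complex.I + h * x * Complex.I : ℂ) = (t + h : ℝ) * x * Complex.I := by
        push_cast
        ring
      rw [h4] at h3
      refine h3.tsum_eq.symm.trans (tsum_congr fun j => ?_)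
      rw [pow_add, mul_right_comm (h : ℂ), mul_pow _ (x : ℂ)]
      ring
    rw [h2]
    refine h1.congr_fun fun j => ?_
    rw [charMoment, ← integral_const_mul]
  · refine Summable.of_nonneg_of_le (fun j => integral_nonneg fun x => norm_nonneg _) (fun j => ?_)
      (summable_taylorBound k)
    refine le_trans ?_ (taylorBound_le hh k j)
    simp only [norm_mul]
    rw [integral_const_mul]
    simp only [← norm_mul]
    have h5 : ‖(h * Complex.I) ^ j / (j.factorial : ℂ)‖ = |h| ^ j / (j.factorial : ℝ) := by
      simp
    rw [h5]
    exact mul_le_mul_of_nonneg_left (integral_norm_charMoment_integrand_le hμ (k + j) t)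
      (by positivity)

/-- Analytic continuation along the real line: at `t = 0` the hypothesis is moment convergence, and
each Taylor step extends the range by `1/4`. All `k` are carried together because a step at `k`
draws on every higher derivative. -/
lemma tendsto_charMoment {μs : ℕ → Measure ℝ} {μ : Measure ℝ}
    (hμs : ∀ᶠ n in atTop, HasExpMoments (μs n)) (hμ : HasExpMoments μ)
    (h : ∀ k : ℕ, Tendsto (fun n => ∫ x : ℝ, x ^ k ∂(μs n)) atTop (𝓝 (∫ x : ℝ, x ^ k ∂μ)))
    (m k : ℕ) (t : ℝ) (ht : |t| ≤ m * 4⁻¹) :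
    Tendsto (fun n => charMoment (μs n) k t) atTop (𝓝 (charMoment μ k t)) := by
  induction m generalizing k t with
  | zero =>
    have ht0 : t = 0 := abs_nonpos_iff.1 (by simpa using ht)
    have h0 : ∀ ν : Measure ℝ, charMoment ν k 0 = ((∫ x : ℝ, x ^ k ∂ν : ℝ) : ℂ) := fun ν => by
      rw [charMoment, ← integral_complex_ofReal]
      simp
    rw [ht0]
    simp only [h0]
    exact (Complex.continuous_ofReal.tendsto _).comp (h k)
  | succ m ih =>
    obtain ⟨s, d, rfl, hs, hd⟩ : ∃ s d : ℝ, t = s + d ∧ |s| ≤ m * 4⁻¹ ∧ |d| ≤ 4⁻¹ := by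
      have hm : (0 : ℝ) < m + 1 := by positivity
      push_cast at ht
      refine ⟨t * (m / (m + 1)), t * (1 / (m + 1)), by field_simp, ?_, ?_⟩
      · rw [abs_mul, abs_of_nonneg (by positivity : (0 : ℝ) ≤ m / (m + 1))]
        calc _ ≤ (m + 1) * 4⁻¹ * (m / (m + 1) : ℝ) := by gcongr
          _ = m * 4⁻¹ := by field_simp
      · rw [abs_mul, abs_of_nonneg (by positivity : (0 : ℝ) ≤ 1 / (m + 1))]
        calc _ ≤ (m + 1) * 4⁻¹ * (1 / (m + 1) : ℝ) := by gcongr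
          _ = 4⁻¹ := by field_simp
    have h1 := tendsto_tsum_of_dominated_convergence (𝓕 := atTop)
      (f := fun n j => (d * Complex.I) ^ j / (j.factorial : ℂ) * charMoment (μs n) (k + j) s)
      (g := fun j => (d * Complex.I) ^ j / (j.factorial : ℂ) * charMoment μ (k + j) s)
      (summable_taylorBound k) (fun j => (ih (k + j) s hs).const_mul _) ?_
    · rw [(hasSum_charMoment hμ hd k s).tsum_eq] at h1
      refine h1.congr' ?_
      filter_upwards [hμs] with n hn
      exact (hasSum_charMoment hn hd k s).tsum_eq
    · filter_upwards [hμs] with n hn j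
      refine le_trans ?_ (taylorBound_le hd k j)
      have h5 : ‖(d * Complex.I) ^ j / (j.factorial : ℂ)‖ = |d| ^ j / (j.factorial : ℝ) := by
        simp
      rw [norm_mul, h5]
      exact mul_le_mul_of_nonneg_left (norm_charMoment_le hn (k + j) s) (by positivity)

lemma hasExpMoments_expMeasure : HasExpMoments (expMeasure 1) where
  nonneg := ae_nonneg_expMeasure
  integrable := integrable_pow_expMeasure
  le k := by
    rw [integral_pow_expMeasure]
    exact le_mul_of_one_le_right (by positivity) (one_le_pow₀ (by norm_num))

/-- A sequence of laws whose moments tend to those of the exponential law of mean `1`, and are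
bounded geometrically relative to them, converges to the exponential law. -/
theorem tendsto_measure_Iio_of_tendsto_moments {μs : ℕ → Measure ℝ}
    [∀ n, IsProbabilityMeasure (μs n)] (hμs : ∀ᶠ n in atTop, HasExpMoments (μs n))
    (h : ∀ k : ℕ, Tendsto (fun n => ∫ x : ℝ, x ^ k ∂(μs n)) atTop (𝓝 (k.factorial : ℝ)))
    {x : ℝ} (hx : 0 ≤ x) :
    Tendsto (fun n => (μs n).real (Iio x)) atTop (𝓝 (1 - Real.exp (-x))) := by
  have : IsProbabilityMeasure (expMeasure 1) := isProbabilityMeasure_expMeasure one_pos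
  have h1 : Tendsto (β := ProbabilityMeasure ℝ) (fun n => ⟨μs n, inferInstance⟩) atTop
      (𝓝 ⟨expMeasure 1, inferInstance⟩) := by
    refine ProbabilityMeasure.tendsto_of_tendsto_charFun fun t => ?_
    obtain ⟨m, hm⟩ := exists_nat_ge (|t| * 4)
    have h2 := tendsto_charMoment hμs hasExpMoments_expMeasure
      (fun k => by rw [integral_pow_expMeasure]; exact h k) m 0 t
      (by rw [← div_eq_mul_inv, le_div_iff₀ (by norm_num)]; exact hm)
    simpa [charMoment, charFun_apply_real] using h2
  have hac : expMeasure 1 ≪ volume := withDensity_absolutelyContinuous _ _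
  have hatom : NullSingletonClass (expMeasure 1) := ⟨fun y => hac (measure_singleton y)⟩
  have h3 := ProbabilityMeasure.tendsto_measure_of_null_frontier_of_tendsto' h1 (E := Iio x)
    (by rw [frontier_Iio]; exact hatom.measure_singleton x)
  have h4 : (expMeasure 1).real (Iio x) = 1 - Real.exp (-x) := by
    rw [measureReal_def, measure_congr Iio_ae_eq_Iic, ← measureReal_def, ← cdf_eq_real,
      cdf_expMeasure_eq one_pos, if_pos hx, one_mul]
  rw [← h4]
  exact (ENNReal.tendsto_toReal (measure_ne_top _ _)).comp h3

/-! ### Right-continuous processes and their integrals -/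

/-- A real process indexed by `ℝ` with right-continuous paths is jointly measurable. -/
lemma measurable_uncurry_of_rightContinuous {Ω : Type*} [MeasurableSpace Ω] {Z : ℝ → Ω → ℝ}
    (hm : ∀ s, Measurable (Z s))
    (hr : ∀ ω s, ContinuousWithinAt (fun s => Z s ω) (Ici s) s) :
    Measurable (Function.uncurry Z) := by
  have hpos : ∀ n : ℕ, (0 : ℝ) < n + 1 := fun n => by positivity
  -- The sampling point `(⌊(n+1)s⌋ + 1)/(n+1)` lies to the right of `s` and within `1/(n+1)` of it,
  -- as right-continuity requires.
  refine measurable_of_tendsto_metrizable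
    (f := fun (n : ℕ) (p : ℝ × Ω) => Z ((⌊((n : ℝ) + 1) * p.1⌋ + 1) / (n + 1)) p.2)
    (fun n => ?_) ?_
  · have h1 : Measurable (fun q : ℤ × Ω => Z (((q.1 : ℝ) + 1) / (n + 1)) q.2) :=
      measurable_from_prod_countable_right fun k => hm (((k : ℝ) + 1) / (n + 1))
    have h2 : Measurable (fun p : ℝ × Ω => (⌊((n : ℝ) + 1) * p.1⌋, p.2)) :=
      (Int.measurable_floor.comp (measurable_fst.const_mul _)).prodMk measurable_snd
    exact h1.comp h2
  · rw [tendsto_pi_nhds]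
    rintro ⟨s, ω⟩
    have h3 : Tendsto (fun n : ℕ => ((⌊((n : ℝ) + 1) * s⌋ : ℝ) + 1) / (n + 1)) atTop (𝓝[≥] s) := by
      refine tendsto_nhdsWithin_iff.2 ⟨?_, Eventually.of_forall fun n => ?_⟩
      · have h4 : Tendsto (fun n : ℕ => s + 1 / ((n : ℝ) + 1)) atTop (𝓝 s) := by
          simpa using tendsto_one_div_add_atTop_nhds_zero_nat.const_add s
        refine tendsto_of_tendsto_of_tendsto_of_le_of_le tendsto_const_nhds h4
          (fun n => ?_) (fun n => ?_)
        · have := hpos n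
          have := Int.lt_floor_add_one (((n : ℝ) + 1) * s)
          change s ≤ _
          rw [le_div_iff₀ (hpos n)]
          linarith
        · have := Int.floor_le (((n : ℝ) + 1) * s)
          change _ ≤ s + 1 / ((n : ℝ) + 1)
          rw [div_le_iff₀ (hpos n), add_mul s, one_div, inv_mul_cancel₀ (hpos n).ne']
          linarith
      · have := Int.lt_floor_add_one (((n : ℝ) + 1) * s)
        change s ≤ _
        rw [le_div_iff₀ (hpos n)]
        linarith
    exact (hr ω s).tendsto.comp h3

lemma measurable_of_rightContinuous {z : ℝ → ℝ} (hr : ∀ s, ContinuousWithinAt z (Ici s) s) :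
    Measurable z :=
  (measurable_uncurry_of_rightContinuous (Ω := Unit) (Z := fun s _ => z s)
    (fun _ => measurable_const) (fun _ s => hr s)).comp (measurable_id.prodMk (measurable_const (a := ())))

/-- The integral over `[0, u]` of a right-continuous process is measurable with respect to every
σ-algebra that the process is adapted to up to time `u`. -/
lemma measurable_integral_of_rightContinuous {Ω : Type*} [MeasurableSpace Ω] {Z : ℝ → Ω → ℝ}
    {u : ℝ} (hu : 0 ≤ u) (hm : ∀ s ∈ Icc 0 u, Measurable (Z s))
    (hr : ∀ ω s, ContinuousWithinAt (fun s => Z s ω) (Ici s) s) :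
    Measurable (fun ω => ∫ s in (0 : ℝ)..u, Z s ω) := by
  -- Clamping the time to `[0, u]` gives a process on the whole line that remains right-continuous
  -- and uses only the times at which `Z` is known to be measurable.
  have h1 : Measurable (Function.uncurry fun (s : ℝ) ω => Z (max 0 (min s u)) ω) := by
    refine measurable_uncurry_of_rightContinuous
      (fun s => hm _ ⟨le_max_left _ _, max_le hu (min_le_right _ _)⟩) fun ω s => ?_
    refine ContinuousWithinAt.comp (g := fun s => Z s ω) (f := fun s => max 0 (min s u))
      (t := Ici (max 0 (min s u))) (hr ω _)
      (Continuous.continuousWithinAt (by fun_prop)) fun x hx => ?_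
    exact max_le_max le_rfl (min_le_min_right u hx)
  have h2 : (fun ω => ∫ s in (0 : ℝ)..u, Z s ω) =
      fun ω => ∫ s in Ioc 0 u, Z (max 0 (min s u)) ω := by
    funext ω
    rw [intervalIntegral.integral_of_le hu]
    refine setIntegral_congr_fun measurableSet_Ioc fun s hs => ?_
    simp only [min_eq_left hs.2, max_eq_right hs.1.le]
  rw [h2]
  exact (h1.stronglyMeasurable.integral_prod_left (μ := volume.restrict (Ioc 0 u))).measurable

lemma intervalIntegrable_of_rightContinuous {z : ℝ → ℝ} {K : ℝ}
    (hr : ∀ s, ContinuousWithinAt z (Ici s) s) (hK : ∀ s, |z s| ≤ K) (a b : ℝ) :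
    IntervalIntegrable z volume a b :=
  (intervalIntegrable_const (c := K)).mono_fun
    (measurable_of_rightContinuous hr).aestronglyMeasurable
    (ae_of_all _ fun s => (hK s).trans (le_abs_self K))

lemma continuous_integral_of_rightContinuous {z : ℝ → ℝ} {K : ℝ}
    (hr : ∀ s, ContinuousWithinAt z (Ici s) s) (hK : ∀ s, |z s| ≤ K) :
    Continuous (fun u => ∫ s in (0 : ℝ)..u, z s) :=
  intervalIntegral.continuous_primitive (intervalIntegrable_of_rightContinuous hr hK) 0

/-- As `z` is only right-continuous, its primitive is differentiated from the right, and the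
fundamental theorem is used in its one-sided form. -/
lemma integral_pow_succ_of_rightContinuous {z : ℝ → ℝ} {K : ℝ}
    (hr : ∀ s, ContinuousWithinAt z (Ici s) s) (hK : ∀ s, |z s| ≤ K) (k : ℕ) {T : ℝ}
    (hT : 0 ≤ T) :
    (∫ s in (0 : ℝ)..T, z s) ^ (k + 1) =
      ∫ u in (0 : ℝ)..T, ((k : ℝ) + 1) * ((∫ s in (0 : ℝ)..u, z s) ^ k * z u) := by
  have hc := continuous_integral_of_rightContinuous hr hK
  have hint := intervalIntegrable_of_rightContinuous hr hK
  refine Eq.symm ((intervalIntegral.integral_eq_sub_of_hasDeriv_right_of_le hT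
    (f := fun u => (∫ s in (0 : ℝ)..u, z s) ^ (k + 1)) (hc.pow (k + 1)).continuousOn
    (fun u _ => ?_) ?_).trans ?_)
  · have h1 : HasDerivWithinAt (fun u => ∫ s in (0 : ℝ)..u, z s) (z u) (Ici u) u :=
      intervalIntegral.integral_hasDerivWithinAt_right (hint 0 u)
        (measurable_of_rightContinuous hr).stronglyMeasurable.stronglyMeasurableAtFilter
        ((hr u).mono Ioi_subset_Ici_self)
    have h2 := (h1.mono Ioi_subset_Ici_self).pow (k + 1)
    refine h2.congr_deriv ?_
    simp only [Nat.add_sub_cancel]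
    push_cast
    ring
  · exact ((hint 0 T).continuousOn_mul (hc.pow k).continuousOn).const_mul _
  · simp

/-! ### Bounds for a convolution over a triangle -/

section Convolution

variable {T C M : ℝ} {p h : ℝ → ℝ}

lemma intervalIntegrable_of_bounded {f : ℝ → ℝ} {a b B : ℝ} (hab : a ≤ b) (hf : Measurable f)
    (hB : ∀ x ∈ Icc a b, |f x| ≤ B) : IntervalIntegrable f volume a b := by
  refine (intervalIntegrable_const (c := B)).mono_fun hf.aestronglyMeasurable ?_
  filter_upwards [ae_restrict_mem measurableSet_uIoc] with x hx
  rw [uIoc_of_le hab] at hx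
  exact (hB x ⟨hx.1.le, hx.2⟩).trans (le_abs_self B)

/-- After both factors are cut off to `(0, S]`, the half-line convolution integrates to the product,
which is the integral over a square in the variables `u` and `s - u`. -/
lemma integral_indicator_posConvolution {S : ℝ} (hS : 0 ≤ S)
    (hp : IntervalIntegrable p volume 0 S) (hh : IntervalIntegrable h volume 0 S) :
    IntegrableOn (fun s => ∫ u in (0 : ℝ)..s,
      (Ioc 0 S).indicator h u * (Ioc 0 S).indicator p (s - u)) (Ioi 0) ∧
    ∫ s in Ioi (0 : ℝ), ∫ u in (0 : ℝ)..s,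
      (Ioc 0 S).indicator h u * (Ioc 0 S).indicator p (s - u) =
      (∫ u in (0 : ℝ)..S, h u) * ∫ u in (0 : ℝ)..S, p u := by
  have h1 : ∀ f : ℝ → ℝ, IntervalIntegrable f volume 0 S →
      IntegrableOn ((Ioc 0 S).indicator f) (Ioi 0) := fun f hf =>
    (((intervalIntegrable_iff_integrableOn_Ioc_of_le hS).1 hf).integrable_indicator
      measurableSet_Ioc).integrableOn
  have h2 : ∀ f : ℝ → ℝ, ∫ x in Ioi (0 : ℝ), (Ioc 0 S).indicator f x = ∫ u in (0 : ℝ)..S, f u :=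
    fun f => by
      rw [setIntegral_indicator measurableSet_Ioc, intervalIntegral.integral_of_le hS,
        inter_eq_right.2 Ioc_subset_Ioi_self]
  have h3 := integral_posConvolution (h1 h hh) (h1 p hp) (ContinuousLinearMap.mul ℝ ℝ)
  have h4 := integrable_posConvolution (h1 h hh) (h1 p hp) (ContinuousLinearMap.mul ℝ ℝ)
  simp only [ContinuousLinearMap.mul_apply', h2] at h3
  refine ⟨?_, h3⟩
  refine h4.integrableOn.congr_fun (fun s hs => ?_) measurableSet_Ioi
  simp [posConvolution, indicator_of_mem hs]

lemma ae_ne_volume (s : ℝ) : ∀ᵐ u : ℝ, u ≠ s := by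
  rw [ae_iff]
  simp

/-- The integral over `[0, T]` of the convolution of two nonnegative functions on `[0, ∞)` lies
between the products of their integrals over `[0, T / 2]` and over `[0, T]`. -/
lemma integral_convolution_bounds (hT : 0 ≤ T) (hp : Continuous p) (hp01 : ∀ t, p t ∈ Icc 0 C)
    (hh : Measurable h) (hh0 : ∀ u ∈ Icc 0 T, h u ∈ Icc 0 M) :
    IntervalIntegrable (fun s => ∫ u in (0 : ℝ)..s, h u * p (s - u)) volume 0 T ∧
    (∫ s in (0 : ℝ)..T, ∫ u in (0 : ℝ)..s, h u * p (s - u)) ≤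
      (∫ u in (0 : ℝ)..T, h u) * ∫ u in (0 : ℝ)..T, p u ∧
    (∫ u in (0 : ℝ)..(T / 2), h u) * (∫ u in (0 : ℝ)..(T / 2), p u) ≤
      ∫ s in (0 : ℝ)..T, ∫ u in (0 : ℝ)..s, h u * p (s - u) := by
  have hI : ∀ S ∈ Icc 0 T, IntervalIntegrable h volume 0 S := fun S hS =>
    intervalIntegrable_of_bounded (B := M) hS.1 hh fun x hx => by
      have := hh0 x ⟨hx.1, hx.2.trans hS.2⟩
      rw [abs_of_nonneg this.1]
      exact this.2
  have hpI : ∀ S, IntervalIntegrable p volume 0 S := fun S => hp.intervalIntegrable 0 S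
  have hprod : ∀ s ∈ Icc 0 T, IntervalIntegrable (fun u => h u * p (s - u)) volume 0 s :=
    fun s hs => (hI s hs).mul_continuousOn (Continuous.continuousOn (by fun_prop))
  obtain ⟨a1, a2⟩ := integral_indicator_posConvolution hT (hpI T) (hI T ⟨hT, le_rfl⟩)
  have hT2 : 0 ≤ T / 2 := by linarith
  obtain ⟨b1, b2⟩ := integral_indicator_posConvolution hT2 (hpI (T / 2))
    (hI (T / 2) ⟨hT2, by linarith⟩)
  have hind : ∀ (S u s : ℝ), S ≤ T →
      0 ≤ (Ioc 0 S).indicator h u * (Ioc 0 S).indicator p (s - u) := by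
    intro S u s hS
    refine mul_nonneg (indicator_nonneg (fun x hx => ?_) _) (indicator_nonneg (fun x hx => ?_) _)
    · exact (hh0 x ⟨hx.1.le, hx.2.trans hS⟩).1
    · exact (hp01 x).1
  have heq : ∀ s ∈ Ioc 0 T, ∫ u in (0 : ℝ)..s,
      (Ioc 0 T).indicator h u * (Ioc 0 T).indicator p (s - u) =
      ∫ u in (0 : ℝ)..s, h u * p (s - u) := by
    intro s hs
    refine intervalIntegral.integral_congr_ae ?_
    -- At `u = s` the cut-off kernel vanishes, since `0` is not in `(0, T]`; this one point is
    -- discarded.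
    filter_upwards [ae_ne_volume s] with u hne hu
    rw [uIoc_of_le hs.1.le] at hu
    have hlt : u < s := lt_of_le_of_ne hu.2 hne
    have hu' : u ∈ Ioc 0 T := ⟨hu.1, hu.2.trans hs.2⟩
    have hsu : s - u ∈ Ioc 0 T := ⟨by linarith, by linarith [hu.1, hs.2]⟩
    rw [indicator_of_mem hu', indicator_of_mem hsu]
  have hint : IntervalIntegrable (fun s => ∫ u in (0 : ℝ)..s, h u * p (s - u)) volume 0 T := by
    rw [intervalIntegrable_iff_integrableOn_Ioc_of_le hT]
    exact (a1.mono_set Ioc_subset_Ioi_self).congr_fun heq measurableSet_Ioc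
  refine ⟨hint, ?_, ?_⟩
  -- The triangle `s ≤ T` is contained in the square of side `T`.
  · rw [← a2, intervalIntegral.integral_of_le hT, ← setIntegral_congr_fun measurableSet_Ioc heq]
    refine setIntegral_mono_set a1 ?_ Ioc_subset_Ioi_self.eventuallyLE
    filter_upwards [ae_restrict_mem measurableSet_Ioi] with s hs
    exact intervalIntegral.integral_nonneg (le_of_lt hs) fun u _ => hind T u s le_rfl
  -- Conversely, if `u` and `s - u` are at most `T / 2`, then `s ≤ T`, so the square of side `T / 2`
  -- lies in the triangle.
  · rw [← b2, intervalIntegral.integral_of_le hT]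
    have hzero : ∀ s ∈ Ioi (0 : ℝ) \ Ioc 0 T, ∫ u in (0 : ℝ)..s,
        (Ioc 0 (T / 2)).indicator h u * (Ioc 0 (T / 2)).indicator p (s - u) = 0 := by
      intro s hs
      have hs' : T < s := by
        by_contra hle
        exact hs.2 ⟨hs.1, not_lt.1 hle⟩
      have hz : ∀ u : ℝ, (Ioc 0 (T / 2)).indicator h u *
          (Ioc 0 (T / 2)).indicator p (s - u) = 0 := by
        intro u
        by_cases hu : u ∈ Ioc 0 (T / 2)
        · rw [indicator_of_notMem (s := Ioc 0 (T / 2)) (f := p), mul_zero]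
          intro hsu
          linarith [hu.2, hsu.2]
        · rw [indicator_of_notMem hu, zero_mul]
      simp only [hz, intervalIntegral.integral_zero]
    rw [setIntegral_eq_of_subset_of_forall_sdiff_eq_zero measurableSet_Ioi
      Ioc_subset_Ioi_self hzero]
    refine setIntegral_mono_on (b1.mono_set Ioc_subset_Ioi_self)
      ((intervalIntegrable_iff_integrableOn_Ioc_of_le hT).1 hint) measurableSet_Ioc fun s hs => ?_
    rw [intervalIntegral.integral_of_le hs.1.le, intervalIntegral.integral_of_le hs.1.le]
    refine integral_mono_of_nonneg (ae_of_all _ fun u => hind (T / 2) u s (by linarith))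
      ((intervalIntegrable_iff_integrableOn_Ioc_of_le hs.1.le).1 (hprod s ⟨hs.1.le, hs.2⟩)) ?_
    filter_upwards [ae_restrict_mem measurableSet_Ioc] with u hu
    have h1 : 0 ≤ h u := (hh0 u ⟨hu.1.le, hu.2.trans hs.2⟩).1
    exact mul_le_mul (indicator_le_self' (fun _ _ => h1) u)
      (indicator_le_self' (fun _ _ => (hp01 _).1) _)
      (indicator_nonneg (fun x _ => (hp01 x).1) _) h1

end Convolution

/-! ### Regular versions of the walk and the Markov property -/

instance : DiscreteMeasurableSpace (HierGroup N) := ⟨fun _ => trivial⟩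

/-- A version of the walk for which all paths start at `x₀` and are right-continuous. -/
structure IsRegularWalk (r : ℕ → ℝ) (x₀ : HierGroup N) {Ω : Type*} [MeasurableSpace Ω]
    (P : Measure Ω) (Y : ℝ≥0 → Ω → HierGroup N) : Prop where
  measurable : ∀ t, Measurable (Y t)
  start : ∀ ω, Y 0 ω = x₀
  indep : HasIndepIncrements Y P
  law : ∀ (s t : ℝ≥0) (y : HierGroup N),
    P.real {ω | Y (s + t) ω - Y s ω = y} = transProb r t y
  rightContinuous : ∀ ω t, ContinuousWithinAt (fun s => Y s ω) (Ici t) t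

lemma IsContinuousTimeWalk.exists_isRegularWalk {r : ℕ → ℝ} {x₀ : HierGroup N} {Ω : Type*}
    [MeasurableSpace Ω] {P : Measure Ω} {X : ℝ≥0 → Ω → HierGroup N}
    (hX : IsContinuousTimeWalk r x₀ P X) :
    ∃ Y : ℝ≥0 → Ω → HierGroup N, IsRegularWalk r x₀ P Y ∧ ∀ᵐ ω ∂P, ∀ t, X t ω = Y t ω := by
  classical
  -- The set of bad paths need not be measurable. Paths in a measurable null superset are replaced
  -- by the constant `x₀`, which affects neither laws nor independence.
  obtain ⟨B, hB, hBm, hB0⟩ := exists_measurable_superset_of_null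
    (ae_iff.1 (hX.start.and hX.cadlag))
  have hgood : ∀ ω ∉ B, X 0 ω = x₀ ∧ ∀ t, ContinuousWithinAt (fun s => X s ω) (Ici t) t := by
    intro ω hω
    by_contra h
    exact hω (hB fun h' => h ⟨h'.1, fun t => (h'.2 t).1⟩)
  have hae : ∀ᵐ ω ∂P, ω ∉ B := measure_eq_zero_iff_ae_notMem.1 hB0
  have hXY : ∀ᵐ ω ∂P, ∀ t, X t ω = if ω ∈ B then x₀ else X t ω := by
    filter_upwards [hae] with ω hω t
    rw [if_neg hω]
  refine ⟨fun t ω => if ω ∈ B then x₀ else X t ω, ⟨fun t => ?_, fun ω => ?_, fun n t ht => ?_,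
    fun s t y => ?_, fun ω t => ?_⟩, hXY⟩
  · exact Measurable.ite hBm measurable_const (hX.measurable t)
  · by_cases hω : ω ∈ B
    · rw [if_pos hω]
    · rw [if_neg hω, (hgood ω hω).1]
  · refine (hX.indep n t ht).congr fun i => ?_
    filter_upwards [hXY] with ω hω
    simp only [← hω]
  · rw [← hX.law s t y]
    refine measureReal_congr (eventuallyEq_set.2 ?_)
    filter_upwards [hXY] with ω hω
    simp only [← hω]
  · by_cases hω : ω ∈ B
    · simp only [if_pos hω]
      exact continuousWithinAt_const
    · simp only [if_neg hω]
      exact (hgood ω hω).2 t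

namespace IsRegularWalk

/-- The σ-algebra generated by the process up to time `u`. -/
abbrev past {Ω : Type*} (Y : ℝ≥0 → Ω → HierGroup N) (u : ℝ≥0) : MeasurableSpace Ω :=
  MeasurableSpace.comap (fun ω (s : Iic u) => Y s ω) inferInstance

lemma measurable_past {Ω : Type*} (Y : ℝ≥0 → Ω → HierGroup N) {u s : ℝ≥0} (hs : s ≤ u) :
    Measurable[past Y u] (Y s) :=
  (measurable_pi_apply (X := fun _ : Iic u => HierGroup N) ⟨s, hs⟩).comp
    (comap_measurable fun ω (s : Iic u) => Y s ω)

variable {r : ℕ → ℝ} {x₀ : HierGroup N} {Ω : Type*} [mΩ : MeasurableSpace Ω]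
  {P : Measure Ω} {Y : ℝ≥0 → Ω → HierGroup N}

lemma past_le (hY : IsRegularWalk r x₀ P Y) (u : ℝ≥0) : past Y u ≤ mΩ :=
  (measurable_pi_lambda _ fun s : Iic u => hY.measurable s).comap_le

variable [NeZero N]

/-- Because the start is deterministic, the positions are functions of the first `n` increments. -/
lemma indepFun_range_sub (hY : IsRegularWalk r x₀ P Y) {t : ℕ → ℝ≥0} (ht : Monotone t)
    (h0 : t 0 = 0) (n : ℕ) :
    IndepFun (fun ω (i : Fin (n + 1)) => Y (t i) ω) (fun ω => Y (t (n + 1)) ω - Y (t n) ω) P := by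
  have h1 := (hY.indep.nat ht).indepFun_finset (Finset.range n) {n} (by simp)
    (fun i => (hY.measurable _).sub (hY.measurable _))
  have hm : Measurable fun (v : Finset.range n → HierGroup N) (i : Fin (n + 1)) =>
      x₀ + ∑ j ∈ (Finset.range i).attach, v ⟨j.1, Finset.mem_range.2
        ((Finset.mem_range.1 j.2).trans_le (Nat.lt_succ_iff.1 i.2))⟩ :=
    measurable_pi_lambda _ fun i => Measurable.of_discrete.comp
      (Finset.measurable_sum _ fun j _ => measurable_pi_apply _)
  have h2 := h1.comp hm (measurable_pi_apply (⟨n, by simp⟩ : ({n} : Finset ℕ)))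
  refine h2.congr (ae_of_all _ fun ω => ?_) (ae_of_all _ fun ω => rfl)
  funext i
  simp only [Function.comp]
  rw [Finset.sum_attach (Finset.range i) (fun j => Y (t (j + 1)) ω - Y (t j) ω),
    Finset.sum_range_sub (fun j => Y (t j) ω), h0, hY.start]
  abel

/-- The finite set of times, with `0` and `u` adjoined, is sorted and then continued by the constant
`T`; its last member is `u`, so the next increment is the one wanted. -/
lemma indepFun_finset_sub (hY : IsRegularWalk r x₀ P Y) {u T : ℝ≥0} (huT : u ≤ T)
    (I : Finset (Iic u)) :
    IndepFun (fun ω (i : I) => Y (i : Iic u) ω) (fun ω => Y T ω - Y u ω) P := by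
  classical
  set J : Finset ℝ≥0 := insert 0 (insert u (I.image Subtype.val)) with hJ
  have hJu : ∀ s ∈ J, s ≤ u := by
    intro s hs
    simp only [hJ, Finset.mem_insert, Finset.mem_image] at hs
    rcases hs with rfl | rfl | ⟨a, _, rfl⟩
    · exact zero_le
    · exact le_rfl
    · exact a.2
  obtain ⟨n, hn⟩ : ∃ n, J.card = n + 1 :=
    ⟨J.card - 1, by have := Finset.card_pos.2 (⟨0, Finset.mem_insert_self 0 _⟩ : J.Nonempty); omega⟩
  set f := J.orderEmbOfFin hn
  have hmem : ∀ i, f i ∈ J := J.orderEmbOfFin_mem hn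
  have hsurj : ∀ s ∈ J, ∃ i, f i = s := fun s hs => by
    have := J.range_orderEmbOfFin hn
    exact (Set.ext_iff.1 this s).2 hs
  set t : ℕ → ℝ≥0 := fun k => if h : k < n + 1 then f ⟨k, h⟩ else T
  have htlt : ∀ k (h : k < n + 1), t k = f ⟨k, h⟩ := fun k h => dif_pos h
  have htge : ∀ k, ¬ k < n + 1 → t k = T := fun k h => dif_neg h
  have htm : Monotone t := by
    intro a b hab
    by_cases hb : b < n + 1
    · rw [htlt a (by omega), htlt b hb]
      exact f.monotone hab
    · rw [htge b hb]
      by_cases ha : a < n + 1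
      · rw [htlt a ha]
        exact (hJu _ (hmem _)).trans huT
      · rw [htge a ha]
  have ht0 : t 0 = 0 := by
    obtain ⟨i, hi⟩ := hsurj 0 (Finset.mem_insert_self 0 _)
    rw [htlt 0 (by omega)]
    refine le_antisymm ?_ zero_le
    rw [← hi]
    exact f.monotone (Fin.mk_le_of_le_val (Nat.zero_le _))
  have htn : t n = u := by
    obtain ⟨i, hi⟩ := hsurj u (by simp [hJ])
    rw [htlt n (by omega)]
    exact le_antisymm (hJu _ (hmem _)) (hi.symm.le.trans (f.monotone (Nat.lt_succ_iff.1 i.2)))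
  have h1 := hY.indepFun_range_sub htm ht0 n
  rw [htn, htge (n + 1) (by omega)] at h1
  have hidx : ∀ i : I, ∃ k : Fin (n + 1), t k = ((i : Iic u) : ℝ≥0) := fun i => by
    obtain ⟨k, hk⟩ := hsurj ((i : Iic u) : ℝ≥0) (by
      simp only [hJ, Finset.mem_insert, Finset.mem_image]
      exact Or.inr (Or.inr ⟨i.1, i.2, rfl⟩))
    exact ⟨k, by rw [htlt k k.2, ← hk]⟩
  choose κ hκ using hidx
  have h2 := h1.comp (φ := fun v i => v (κ i)) (ψ := id)
    (measurable_pi_lambda _ fun i => measurable_pi_apply _) measurable_id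
  refine h2.congr (ae_of_all _ fun ω => ?_) (ae_of_all _ fun ω => rfl)
  funext i
  simp only [Function.comp, hκ]

variable [IsProbabilityMeasure P]

lemma indepFun_past_sub (hY : IsRegularWalk r x₀ P Y) {u T : ℝ≥0} (huT : u ≤ T) :
    IndepFun (fun ω (s : Iic u) => Y s ω) (fun ω => Y T ω - Y u ω) P :=
  IndepFun.process_indepFun (fun s => hY.measurable s) ((hY.measurable T).sub (hY.measurable u))
    fun I => hY.indepFun_finset_sub huT I

lemma indepFun_of_measurable_past (hY : IsRegularWalk r x₀ P Y) {u T : ℝ≥0} (huT : u ≤ T)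
    {G : Ω → ℝ} (hG : Measurable[past Y u] G) :
    IndepFun G (fun ω => Y T ω - Y u ω) P := by
  have h := hY.indepFun_past_sub huT
  rw [IndepFun_iff_Indep] at h ⊢
  exact indep_of_indep_of_le_left h hG.comap_le

lemma integral_mul_indicator_sub (hY : IsRegularWalk r x₀ P Y) {u T : ℝ≥0} (huT : u ≤ T)
    {G : Ω → ℝ} (hG : Measurable[past Y u] G) (w : HierGroup N) :
    ∫ ω, G ω * ({w} : Set (HierGroup N)).indicator 1 (Y T ω - Y u ω) ∂P =
      (∫ ω, G ω ∂P) * transProb r (T - u : ℝ≥0) w := by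
  have hm : Measurable (({w} : Set (HierGroup N)).indicator (1 : HierGroup N → ℝ)) :=
    Measurable.of_discrete
  have hV : Measurable fun ω => Y T ω - Y u ω := (hY.measurable T).sub (hY.measurable u)
  have h1 := (hY.indepFun_of_measurable_past huT hG).comp measurable_id hm
  have h2 := h1.integral_fun_mul_eq_mul_integral
    ((hG.mono (hY.past_le u) le_rfl).aestronglyMeasurable) (hm.comp hV).aestronglyMeasurable
  simp only [Function.comp, id] at h2
  rw [h2]
  congr 1
  rw [← hY.law u (T - u) w, add_tsub_cancel_of_le huT]
  have h3 : (fun ω => ({w} : Set (HierGroup N)).indicator (1 : HierGroup N → ℝ) (Y T ω - Y u ω)) =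
      {ω | Y T ω - Y u ω = w}.indicator 1 := rfl
  rw [h3, integral_indicator_one]
  exact hV (measurableSet_singleton w)

/-- A function with bounded support is a combination of indicators of points. -/
lemma eq_sum_ball {F : HierGroup N → ℝ} {R : ℕ} (hF : ∀ y, F y ≠ 0 → hnorm y ≤ R)
    (x : HierGroup N) :
    F x = ∑ y ∈ ball R, F y * ({y} : Set (HierGroup N)).indicator 1 x := by
  classical
  simp only [indicator_apply, mem_singleton_iff, Pi.one_apply, mul_ite, mul_one, mul_zero]
  rw [Finset.sum_ite_eq]
  split_ifs with h
  · rfl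
  · by_contra hne
    exact h (mem_ball.2 (hF x hne))

lemma tsum_eq_sum_ball {F : HierGroup N → ℝ} {R : ℕ} (hF : ∀ y, F y ≠ 0 → hnorm y ≤ R) :
    ∑' y, F y = ∑ y ∈ ball R, F y :=
  tsum_eq_sum fun y hy => by
    by_contra hne
    exact hy (mem_ball.2 (hF y hne))

/-- The Markov property at time `u`, for functions with bounded support. -/
lemma integral_mul_mul_eq (hY : IsRegularWalk r x₀ P Y) {u T : ℝ≥0} (huT : u ≤ T)
    {G : Ω → ℝ} (hG : Measurable[past Y u] G) (hGi : Integrable G P)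
    {F : HierGroup N → ℝ} {R : ℕ} (hF : ∀ y, F y ≠ 0 → hnorm y ≤ R) :
    ∫ ω, G ω * F (Y u ω) * F (Y T ω) ∂P = ∑ y ∈ ball R, ∑ z ∈ ball R, F y * F z *
      ((∫ ω, G ω * ({y} : Set (HierGroup N)).indicator 1 (Y u ω) ∂P) *
        transProb r (T - u : ℝ≥0) (z - y)) := by
  classical
  have hm : ∀ y : HierGroup N, Measurable[past Y u]
      fun ω => ({y} : Set (HierGroup N)).indicator (1 : HierGroup N → ℝ) (Y u ω) := fun y =>
    (Measurable.of_discrete (f := ({y} : Set (HierGroup N)).indicator (1 : HierGroup N → ℝ))).comp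
      (measurable_past Y le_rfl)
  have h01 : ∀ y x : HierGroup N,
      ‖({y} : Set (HierGroup N)).indicator (1 : HierGroup N → ℝ) x‖ ≤ 1 := fun y x => by
    unfold indicator
    split_ifs <;> simp
  have hGy : ∀ y : HierGroup N, Measurable[past Y u]
      fun ω => G ω * ({y} : Set (HierGroup N)).indicator (1 : HierGroup N → ℝ) (Y u ω) :=
    fun y => hG.mul (hm y)
  have hGyi : ∀ y : HierGroup N, Integrable
      (fun ω => G ω * ({y} : Set (HierGroup N)).indicator (1 : HierGroup N → ℝ) (Y u ω)) P :=
    fun y => hGi.mul_bdd (c := 1) ((hm y).mono (hY.past_le u) le_rfl).aestronglyMeasurable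
      (ae_of_all _ fun ω => h01 y _)
  have hV : Measurable fun ω => Y T ω - Y u ω := (hY.measurable T).sub (hY.measurable u)
  -- On the event that the position at time `u` is `y`, being at `z` at time `T` means that the
  -- increment is `z - y`, which is independent of the past.
  have key : ∀ ω, G ω * F (Y u ω) * F (Y T ω) = ∑ y ∈ ball R, ∑ z ∈ ball R, F y * F z *
      (G ω * ({y} : Set (HierGroup N)).indicator 1 (Y u ω) *
        ({z - y} : Set (HierGroup N)).indicator 1 (Y T ω - Y u ω)) := by
    intro ω
    rw [eq_sum_ball hF (Y u ω), Finset.mul_sum, Finset.sum_mul]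
    refine Finset.sum_congr rfl fun y _ => ?_
    by_cases hy : Y u ω = y
    · rw [eq_sum_ball hF (Y T ω), Finset.mul_sum]
      refine Finset.sum_congr rfl fun z _ => ?_
      have : ({z - y} : Set (HierGroup N)).indicator (1 : HierGroup N → ℝ) (Y T ω - Y u ω) =
          ({z} : Set (HierGroup N)).indicator 1 (Y T ω) := by
        simp only [indicator_apply, mem_singleton_iff, hy, sub_left_inj, Pi.one_apply]
      rw [this]
      ring
    · have : ({y} : Set (HierGroup N)).indicator (1 : HierGroup N → ℝ) (Y u ω) = 0 :=
        indicator_of_notMem (s := {y}) hy _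
      rw [this]
      simp
  simp only [key]
  have hi : ∀ y z : HierGroup N, Integrable (fun ω => F y * F z *
      (G ω * ({y} : Set (HierGroup N)).indicator 1 (Y u ω) *
        ({z - y} : Set (HierGroup N)).indicator 1 (Y T ω - Y u ω))) P := fun y z =>
    ((hGyi y).mul_bdd (c := 1) ((Measurable.of_discrete (f :=
      ({z - y} : Set (HierGroup N)).indicator (1 : HierGroup N → ℝ))).comp hV).aestronglyMeasurable
      (ae_of_all _ fun ω => h01 _ _)).const_mul _
  rw [integral_finsetSum _ fun y _ => integrable_finsetSum _ fun z _ => hi y z]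
  refine Finset.sum_congr rfl fun y _ => ?_
  rw [integral_finsetSum _ fun z _ => hi y z]
  refine Finset.sum_congr rfl fun z _ => ?_
  rw [integral_const_mul, hY.integral_mul_indicator_sub huT (hGy y)]

/-- The ball is a subgroup, so displacements between points of the support of `F` stay within the
same radius `R`, and one pair of bounds serves for all of them. -/
lemma integral_mul_mul_bounds (hY : IsRegularWalk r x₀ P Y) {u T : ℝ≥0} (huT : u ≤ T)
    {G : Ω → ℝ} (hG : Measurable[past Y u] G) (hGi : Integrable G P) (hG0 : ∀ ω, 0 ≤ G ω)
    {F : HierGroup N → ℝ} (hF0 : ∀ y, 0 ≤ F y) {R : ℕ} (hF : ∀ y, F y ≠ 0 → hnorm y ≤ R)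
    {a b : ℝ} (hab : ∀ w : HierGroup N, hnorm w ≤ R → transProb r (T - u : ℝ≥0) w ∈ Icc a b) :
    ∫ ω, G ω * F (Y u ω) * F (Y T ω) ∂P ∈ Icc (a * (∑' y, F y) * ∫ ω, G ω * F (Y u ω) ∂P)
      (b * (∑' y, F y) * ∫ ω, G ω * F (Y u ω) ∂P) := by
  have h01 : ∀ y x : HierGroup N,
      ({y} : Set (HierGroup N)).indicator (1 : HierGroup N → ℝ) x ∈ Icc 0 1 := fun y x => by
    unfold indicator
    split_ifs <;> simp
  have hGyi : ∀ y : HierGroup N, Integrable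
      (fun ω => G ω * ({y} : Set (HierGroup N)).indicator (1 : HierGroup N → ℝ) (Y u ω)) P :=
    fun y => hGi.mul_bdd (c := 1) ((Measurable.of_discrete (f :=
      ({y} : Set (HierGroup N)).indicator (1 : HierGroup N → ℝ))).comp
        (hY.measurable u)).aestronglyMeasurable
      (ae_of_all _ fun ω => by rw [Real.norm_of_nonneg (h01 y _).1]; exact (h01 y _).2)
  have hGF : ∫ ω, G ω * F (Y u ω) ∂P = ∑ y ∈ ball R, F y *
      ∫ ω, G ω * ({y} : Set (HierGroup N)).indicator 1 (Y u ω) ∂P := by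
    simp only [← integral_const_mul]
    rw [← integral_finsetSum _ fun y _ => (hGyi y).const_mul _]
    refine integral_congr_ae (ae_of_all _ fun ω => ?_)
    simp only
    rw [eq_sum_ball hF (Y u ω), Finset.mul_sum]
    refine Finset.sum_congr rfl fun y _ => by ring
  have hE : ∀ y : HierGroup N,
      0 ≤ ∫ ω, G ω * ({y} : Set (HierGroup N)).indicator 1 (Y u ω) ∂P := fun y =>
    integral_nonneg fun ω => mul_nonneg (hG0 ω) (h01 y _).1
  rw [hY.integral_mul_mul_eq huT hG hGi hF, hGF, tsum_eq_sum_ball hF]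
  have hconst : ∀ κ : ℝ, κ * (∑ y ∈ ball R, F y) * (∑ y ∈ ball R, F y *
      ∫ ω, G ω * ({y} : Set (HierGroup N)).indicator 1 (Y u ω) ∂P) =
      ∑ y ∈ ball R, ∑ z ∈ ball R, F y * F z *
      ((∫ ω, G ω * ({y} : Set (HierGroup N)).indicator 1 (Y u ω) ∂P) * κ) := fun κ => by
    rw [Finset.mul_sum]
    refine Finset.sum_congr rfl fun y _ => ?_
    rw [mul_comm κ, mul_assoc, Finset.sum_mul]
    refine Finset.sum_congr rfl fun z _ => by ring
  rw [hconst, hconst]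
  constructor
  · refine Finset.sum_le_sum fun y hy => Finset.sum_le_sum fun z hz => ?_
    have hw := hab (z - y) (hnorm_sub_le (mem_ball.1 hz) (mem_ball.1 hy))
    exact mul_le_mul_of_nonneg_left (mul_le_mul_of_nonneg_left hw.1 (hE y))
      (mul_nonneg (hF0 y) (hF0 z))
  · refine Finset.sum_le_sum fun y hy => Finset.sum_le_sum fun z hz => ?_
    have hw := hab (z - y) (hnorm_sub_le (mem_ball.1 hz) (mem_ball.1 hy))
    exact mul_le_mul_of_nonneg_left (mul_le_mul_of_nonneg_left hw.2 (hE y))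
      (mul_nonneg (hF0 y) (hF0 z))

end IsRegularWalk

/-! ### Moments of the occupation time -/

/-- The occupation time functional `∫₀ᵀ F (Y s) ds`. -/
def occTime {Ω : Type*} (F : HierGroup N → ℝ) (Y : ℝ≥0 → Ω → HierGroup N) (T : ℝ) (ω : Ω) : ℝ :=
  ∫ s in (0 : ℝ)..T, F (Y s.toNNReal ω)

/-- The rate of growth of the moments of the occupation time. -/
def occRate {Ω : Type*} [MeasurableSpace Ω] (P : Measure Ω) (F : HierGroup N → ℝ)
    (Y : ℝ≥0 → Ω → HierGroup N) (k : ℕ) (u : ℝ) : ℝ :=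
  ∫ ω, occTime F Y u ω ^ k * F (Y u.toNNReal ω) ∂P

namespace IsRegularWalk

variable {r : ℕ → ℝ} {x₀ : HierGroup N} {Ω : Type*} [mΩ : MeasurableSpace Ω]
  {P : Measure Ω} {Y : ℝ≥0 → Ω → HierGroup N} {F : HierGroup N → ℝ} {K : ℝ}

lemma continuousWithinAt_comp (hY : IsRegularWalk r x₀ P Y) (F : HierGroup N → ℝ) (ω : Ω)
    (s : ℝ) : ContinuousWithinAt (fun s : ℝ => F (Y s.toNNReal ω)) (Ici s) s := by
  have h1 : ContinuousWithinAt (fun s : ℝ => Y s.toNNReal ω) (Ici s) s :=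
    (hY.rightContinuous ω s.toNNReal).comp continuous_real_toNNReal.continuousWithinAt
      fun x hx => Real.toNNReal_le_toNNReal hx
  exact (continuous_of_discreteTopology (f := F)).continuousAt.comp_continuousWithinAt h1

lemma measurable_comp (hY : IsRegularWalk r x₀ P Y) (F : HierGroup N → ℝ) (s : ℝ) :
    Measurable fun ω => F (Y s.toNNReal ω) :=
  (Measurable.of_discrete (f := F)).comp (hY.measurable _)

lemma measurable_uncurry_comp (hY : IsRegularWalk r x₀ P Y) (F : HierGroup N → ℝ) :
    Measurable (Function.uncurry fun (s : ℝ) ω => F (Y s.toNNReal ω)) :=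
  measurable_uncurry_of_rightContinuous (hY.measurable_comp F) (hY.continuousWithinAt_comp F)

lemma measurable_past_occTime (hY : IsRegularWalk r x₀ P Y) (F : HierGroup N → ℝ) (u : ℝ≥0) :
    Measurable[past Y u] (occTime F Y u) :=
  @measurable_integral_of_rightContinuous Ω (past Y u) _ u u.2
    (fun _ hs => (Measurable.of_discrete (f := F)).comp
      (measurable_past Y (Real.toNNReal_le_iff_le_coe.2 hs.2)))
    (hY.continuousWithinAt_comp F)

lemma continuous_occTime (hY : IsRegularWalk r x₀ P Y) (hF : ∀ y, F y ∈ Icc 0 K) (ω : Ω) :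
    Continuous fun u => occTime F Y u ω :=
  continuous_integral_of_rightContinuous (K := K) (hY.continuousWithinAt_comp F ω) fun s => by
    rw [abs_of_nonneg (hF _).1]
    exact (hF _).2

lemma measurable_uncurry_occTime (hY : IsRegularWalk r x₀ P Y) (hF : ∀ y, F y ∈ Icc 0 K) :
    Measurable (Function.uncurry fun (u : ℝ) ω => occTime F Y u ω) := by
  refine measurable_uncurry_of_rightContinuous (fun u => ?_)
    fun ω s => (hY.continuous_occTime hF ω).continuousWithinAt
  have h := (hY.measurable_uncurry_comp F).stronglyMeasurable
  exact ((h.integral_prod_left (μ := volume.restrict (Ioc 0 u))).sub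
    (h.integral_prod_left (μ := volume.restrict (Ioc u 0)))).measurable

lemma occTime_mem_Icc (hY : IsRegularWalk r x₀ P Y) (hF : ∀ y, F y ∈ Icc 0 K) {u : ℝ}
    (hu : 0 ≤ u) (ω : Ω) : occTime F Y u ω ∈ Icc 0 (K * u) := by
  refine ⟨intervalIntegral.integral_nonneg hu fun s _ => (hF _).1, ?_⟩
  have h : ∫ s in (0 : ℝ)..u, F (Y s.toNNReal ω) ≤ ∫ _ in (0 : ℝ)..u, K :=
    intervalIntegral.integral_mono_on hu
      (intervalIntegrable_of_rightContinuous (K := K) (hY.continuousWithinAt_comp F ω)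
        (fun s => by rw [abs_of_nonneg (hF _).1]; exact (hF _).2) 0 u)
      intervalIntegrable_const fun s _ => (hF _).2
  refine h.trans (le_of_eq ?_)
  rw [intervalIntegral.integral_const, sub_zero, smul_eq_mul, mul_comm]

lemma pow_occTime_mul_mem_Icc (hY : IsRegularWalk r x₀ P Y) (hF : ∀ y, F y ∈ Icc 0 K) {u T : ℝ}
    (hu : u ∈ Icc 0 T) (k : ℕ) (ω : Ω) :
    occTime F Y u ω ^ k * F (Y u.toNNReal ω) ∈ Icc 0 ((K * T) ^ k * K) := by
  have h1 := hY.occTime_mem_Icc hF hu.1 ω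
  have h2 := hF (Y u.toNNReal ω)
  have hK : 0 ≤ K := h2.1.trans h2.2
  have h3 : occTime F Y u ω ≤ K * T := h1.2.trans (mul_le_mul_of_nonneg_left hu.2 hK)
  exact ⟨mul_nonneg (pow_nonneg h1.1 k) h2.1,
    mul_le_mul (pow_le_pow_left₀ h1.1 h3 k) h2.2 h2.1 (pow_nonneg (h1.1.trans h3) k)⟩

lemma measurable_uncurry_pow_occTime_mul (hY : IsRegularWalk r x₀ P Y)
    (hF : ∀ y, F y ∈ Icc 0 K) (k : ℕ) :
    Measurable (Function.uncurry fun (u : ℝ) ω => occTime F Y u ω ^ k * F (Y u.toNNReal ω)) :=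
  ((hY.measurable_uncurry_occTime hF).pow_const k).mul (hY.measurable_uncurry_comp F)

variable [IsProbabilityMeasure P]

lemma measurable_occRate (hY : IsRegularWalk r x₀ P Y) (hF : ∀ y, F y ∈ Icc 0 K) (k : ℕ) :
    Measurable (occRate P F Y k) :=
  (hY.measurable_uncurry_pow_occTime_mul hF k).stronglyMeasurable.integral_prod_right.measurable

lemma integrable_pow_occTime_mul (hY : IsRegularWalk r x₀ P Y) (hF : ∀ y, F y ∈ Icc 0 K)
    {u : ℝ} (hu : 0 ≤ u) (k : ℕ) :
    Integrable (fun ω => occTime F Y u ω ^ k * F (Y u.toNNReal ω)) P := by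
  refine Integrable.of_bound (C := (K * u) ^ k * K) ((hY.measurable_uncurry_pow_occTime_mul hF k).comp
    measurable_prodMk_left).aestronglyMeasurable (ae_of_all _ fun ω => ?_)
  have := hY.pow_occTime_mul_mem_Icc hF (⟨hu, le_rfl⟩ : u ∈ Icc 0 u) k ω
  rw [Real.norm_of_nonneg this.1]
  exact this.2

lemma integrable_pow_occTime (hY : IsRegularWalk r x₀ P Y) (hF : ∀ y, F y ∈ Icc 0 K)
    {u : ℝ} (hu : 0 ≤ u) (k : ℕ) : Integrable (fun ω => occTime F Y u ω ^ k) P := by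
  refine Integrable.of_bound (C := (K * u) ^ k) (((hY.measurable_uncurry_occTime hF).comp
    measurable_prodMk_left).pow_const k).aestronglyMeasurable (ae_of_all _ fun ω => ?_)
  have := hY.occTime_mem_Icc hF hu ω
  rw [norm_pow, Real.norm_of_nonneg this.1]
  exact pow_le_pow_left₀ this.1 this.2 k

lemma occRate_mem_Icc (hY : IsRegularWalk r x₀ P Y) (hF : ∀ y, F y ∈ Icc 0 K) {u T : ℝ}
    (hu : u ∈ Icc 0 T) (k : ℕ) : occRate P F Y k u ∈ Icc 0 ((K * T) ^ k * K) := by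
  refine ⟨integral_nonneg fun ω => (hY.pow_occTime_mul_mem_Icc hF hu k ω).1, ?_⟩
  refine (integral_mono (hY.integrable_pow_occTime_mul hF hu.1 k) (integrable_const _)
    fun ω => (hY.pow_occTime_mul_mem_Icc hF hu k ω).2).trans (by simp)

lemma intervalIntegrable_occRate (hY : IsRegularWalk r x₀ P Y) (hF : ∀ y, F y ∈ Icc 0 K)
    {T : ℝ} (hT : 0 ≤ T) (k : ℕ) : IntervalIntegrable (occRate P F Y k) volume 0 T :=
  intervalIntegrable_of_bounded (B := (K * T) ^ k * K) hT (hY.measurable_occRate hF k)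
    fun u hu => by
      have := hY.occRate_mem_Icc (P := P) hF hu k
      rw [abs_of_nonneg this.1]
      exact this.2

/-- Pathwise fundamental theorem and Fubini. The weight `V = 1` yields the moments, and `V = F (Y
T)` yields the recursion for the rates. -/
lemma integral_pow_occTime_succ_mul (hY : IsRegularWalk r x₀ P Y) (hF : ∀ y, F y ∈ Icc 0 K)
    {T : ℝ} (hT : 0 ≤ T) (k : ℕ) {V : Ω → ℝ} (hV : Measurable V) {L : ℝ} (hVL : ∀ ω, |V ω| ≤ L) :
    ∫ ω, occTime F Y T ω ^ (k + 1) * V ω ∂P =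
      ((k : ℝ) + 1) * ∫ u in (0 : ℝ)..T,
        ∫ ω, occTime F Y u ω ^ k * F (Y u.toNNReal ω) * V ω ∂P := by
  have h1 : ∀ ω, occTime F Y T ω ^ (k + 1) * V ω = ∫ u in (0 : ℝ)..T,
      ((k : ℝ) + 1) * (occTime F Y u ω ^ k * F (Y u.toNNReal ω) * V ω) := fun ω => by
    have := integral_pow_succ_of_rightContinuous (K := K) (hY.continuousWithinAt_comp F ω)
      (fun s => by rw [abs_of_nonneg (hF _).1]; exact (hF _).2) k hT
    unfold occTime
    rw [this, ← intervalIntegral.integral_mul_const]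
    refine intervalIntegral.integral_congr fun u _ => ?_
    simp only [mul_assoc]
  simp only [h1]
  rw [← intervalIntegral_integral_swap, ← intervalIntegral.integral_const_mul]
  · refine intervalIntegral.integral_congr fun u _ => ?_
    rw [integral_const_mul]
  · rw [uIoc_of_le hT]
    have hm : Measurable (Function.uncurry fun (u : ℝ) ω =>
        ((k : ℝ) + 1) * (occTime F Y u ω ^ k * F (Y u.toNNReal ω) * V ω)) :=
      (((hY.measurable_uncurry_pow_occTime_mul hF k).mul (hV.comp measurable_snd)).const_mul _)
    refine Integrable.of_bound (C := ((k : ℝ) + 1) * ((K * T) ^ k * K * L))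
      hm.aestronglyMeasurable ?_
    have h2 : ∀ᵐ q : ℝ × Ω ∂((volume.restrict (Ioc 0 T)).prod P), q.1 ∈ Ioc 0 T :=
      Measure.quasiMeasurePreserving_fst.ae (ae_restrict_mem measurableSet_Ioc)
    filter_upwards [h2] with q hq
    have h3 := hY.pow_occTime_mul_mem_Icc hF ⟨hq.1.le, hq.2⟩ k q.2
    have h4 : (0 : ℝ) ≤ k + 1 := by positivity
    simp only [Function.uncurry]
    rw [norm_mul, norm_mul, Real.norm_of_nonneg h3.1, Real.norm_of_nonneg h4]
    exact mul_le_mul_of_nonneg_left (mul_le_mul h3.2 (hVL _) (abs_nonneg _) (h3.1.trans h3.2)) h4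

lemma integral_pow_occTime_succ (hY : IsRegularWalk r x₀ P Y) (hF : ∀ y, F y ∈ Icc 0 K)
    {T : ℝ} (hT : 0 ≤ T) (k : ℕ) :
    ∫ ω, occTime F Y T ω ^ (k + 1) ∂P =
      ((k : ℝ) + 1) * ∫ u in (0 : ℝ)..T, occRate P F Y k u := by
  simpa [occRate] using hY.integral_pow_occTime_succ_mul hF hT k (measurable_const (a := (1 : ℝ)))
    (L := 1) (fun _ => by simp)

lemma occRate_succ (hY : IsRegularWalk r x₀ P Y) (hF : ∀ y, F y ∈ Icc 0 K) {T : ℝ} (hT : 0 ≤ T)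
    (k : ℕ) :
    occRate P F Y (k + 1) T = ((k : ℝ) + 1) * ∫ u in (0 : ℝ)..T,
      ∫ ω, occTime F Y u ω ^ k * F (Y u.toNNReal ω) * F (Y T.toNNReal ω) ∂P :=
  hY.integral_pow_occTime_succ_mul hF hT k (hY.measurable_comp F T) (L := K) fun ω => by
    rw [abs_of_nonneg (hF _).1]
    exact (hF _).2

section Bounds

variable [NeZero N] {R : ℕ} {p q : ℝ → ℝ} {C : ℝ}

lemma occRate_zero_bounds (hY : IsRegularWalk r x₀ P Y) (hF : ∀ y, F y ∈ Icc 0 K)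
    (hR : ∀ y, F y ≠ 0 → hnorm y ≤ R) (hx₀ : hnorm x₀ ≤ R) {a b u : ℝ} (hu : 0 ≤ u)
    (hab : ∀ w : HierGroup N, hnorm w ≤ R → transProb r u w ∈ Icc a b) :
    occRate P F Y 0 u ∈ Icc (a * ∑' y, F y) (b * ∑' y, F y) := by
  classical
  have h1 : ∀ z : HierGroup N,
      ∫ ω, ({z} : Set (HierGroup N)).indicator (1 : HierGroup N → ℝ) (Y u.toNNReal ω) ∂P =
        transProb r u (z - x₀) := fun z => by
    have h := hY.integral_mul_indicator_sub (u := 0) (T := u.toNNReal) zero_le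
      (G := fun _ => 1) measurable_const (z - x₀)
    simp only [one_mul, tsub_zero, Real.coe_toNNReal u hu, integral_const, probReal_univ,
      smul_eq_mul, hY.start] at h
    rw [← h]
    refine integral_congr_ae (ae_of_all _ fun ω => ?_)
    simp only [indicator_apply, mem_singleton_iff, sub_left_inj, Pi.one_apply]
  have h2 : occRate P F Y 0 u = ∑ z ∈ ball R, F z * transProb r u (z - x₀) := by
    simp only [occRate, pow_zero, one_mul, ← h1, ← integral_const_mul]
    rw [← integral_finsetSum _ fun z _ => ?_]
    · exact integral_congr_ae (ae_of_all _ fun ω => eq_sum_ball hR _)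
    · refine Integrable.const_mul (Integrable.of_bound (C := 1) ((Measurable.of_discrete (f :=
        ({z} : Set (HierGroup N)).indicator (1 : HierGroup N → ℝ))).comp
        (hY.measurable _)).aestronglyMeasurable (ae_of_all _ fun ω => ?_)) _
      simp only [Function.comp, indicator_apply]
      split_ifs <;> simp
  rw [h2, tsum_eq_sum_ball hR, Finset.mul_sum, Finset.mul_sum]
  have h3 : ∀ z ∈ ball R, transProb r u (z - x₀) ∈ Icc a b := fun z hz =>
    hab (z - x₀) (hnorm_sub_le (mem_ball.1 hz) hx₀)
  constructor
  · refine Finset.sum_le_sum fun z hz => ?_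
    rw [mul_comm]
    exact mul_le_mul_of_nonneg_left (h3 z hz).1 (hF z).1
  · refine Finset.sum_le_sum fun z hz => ?_
    rw [mul_comm b]
    exact mul_le_mul_of_nonneg_left (h3 z hz).2 (hF z).1

/-- One step of the moment recursion, for walks whose transition probabilities on the ball of
radius `R` lie between the kernels `q` and `p`. -/
lemma integral_occRate_succ_bounds (hY : IsRegularWalk r x₀ P Y) (hF : ∀ y, F y ∈ Icc 0 K)
    (hR : ∀ y, F y ≠ 0 → hnorm y ≤ R) (hp : Continuous p) (hq : Continuous q)
    (hp01 : ∀ t, p t ∈ Icc 0 C) (hq01 : ∀ t, q t ∈ Icc 0 C)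
    (hpq : ∀ t, 0 ≤ t → ∀ w : HierGroup N, hnorm w ≤ R → transProb r t w ∈ Icc (q t) (p t))
    {T : ℝ} (hT : 0 ≤ T) (k : ℕ) :
    ∫ u in (0 : ℝ)..T, occRate P F Y (k + 1) u ∈ Icc
      (((k : ℝ) + 1) * (∑' y, F y) * ((∫ u in (0 : ℝ)..(T / 2), occRate P F Y k u) *
        ∫ u in (0 : ℝ)..(T / 2), q u))
      (((k : ℝ) + 1) * (∑' y, F y) * ((∫ u in (0 : ℝ)..T, occRate P F Y k u) *
        ∫ u in (0 : ℝ)..T, p u)) := by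
  have hsum : 0 ≤ ∑' y, F y := tsum_nonneg fun y => (hF y).1
  have hk : (0 : ℝ) ≤ k + 1 := by positivity
  have hm := hY.measurable_occRate hF k (P := P)
  have hh0 : ∀ u ∈ Icc 0 T, occRate P F Y k u ∈ Icc 0 ((K * T) ^ k * K) := fun u hu =>
    hY.occRate_mem_Icc hF hu k
  obtain ⟨p1, p2, -⟩ := integral_convolution_bounds hT hp hp01 hm hh0
  obtain ⟨q1, -, q3⟩ := integral_convolution_bounds hT hq hq01 hm hh0
  -- The Markov property at `u`, where the `k`-th power of the occupation time up to `u` is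
  -- measurable with respect to the past.
  have hstep : ∀ s ∈ Icc 0 T, ∀ u ∈ Icc 0 s,
      ∫ ω, occTime F Y u ω ^ k * F (Y u.toNNReal ω) * F (Y s.toNNReal ω) ∂P ∈ Icc
        ((∑' y, F y) * (occRate P F Y k u * q (s - u)))
        ((∑' y, F y) * (occRate P F Y k u * p (s - u))) := by
    intro s hs u hu
    have hG : Measurable[past Y u.toNNReal] fun ω => occTime F Y u ω ^ k := by
      have := (hY.measurable_past_occTime F u.toNNReal).pow_const k
      rwa [Real.coe_toNNReal u hu.1] at this
    have h := hY.integral_mul_mul_bounds (Real.toNNReal_le_toNNReal hu.2) hG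
      (hY.integrable_pow_occTime hF hu.1 k)
      (fun ω => pow_nonneg (hY.occTime_mem_Icc hF hu.1 ω).1 k) (fun y => (hF y).1) hR
      (a := q (s - u)) (b := p (s - u)) fun w hw => by
        rw [NNReal.coe_sub (Real.toNNReal_le_toNNReal hu.2), Real.coe_toNNReal s hs.1,
          Real.coe_toNNReal u hu.1]
        exact hpq _ (sub_nonneg.2 hu.2) w hw
    unfold occRate
    refine ⟨le_trans (le_of_eq (by ring)) h.1, h.2.trans (le_of_eq (by ring))⟩
  have hprod : ∀ (f : ℝ → ℝ), Continuous f → ∀ s ∈ Icc 0 T,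
      IntervalIntegrable (fun u => occRate P F Y k u * f (s - u)) volume 0 s := fun f hf s hs =>
    (hY.intervalIntegrable_occRate hF hs.1 k).mul_continuousOn
      (Continuous.continuousOn (by fun_prop))
  have hmid : ∀ s ∈ Icc 0 T, IntervalIntegrable (fun u =>
      ∫ ω, occTime F Y u ω ^ k * F (Y u.toNNReal ω) * F (Y s.toNNReal ω) ∂P) volume 0 s := by
    intro s hs
    have hm2 : Measurable fun u =>
        ∫ ω, occTime F Y u ω ^ k * F (Y u.toNNReal ω) * F (Y s.toNNReal ω) ∂P :=
      (((hY.measurable_uncurry_pow_occTime_mul hF k).mul ((hY.measurable_comp F s).comp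
        measurable_snd)).stronglyMeasurable.integral_prod_right (f := fun (u : ℝ) ω =>
          occTime F Y u ω ^ k * F (Y u.toNNReal ω) * F (Y s.toNNReal ω))).measurable
    refine ((hprod p hp s hs).const_mul (∑' y, F y)).mono_fun hm2.aestronglyMeasurable ?_
    filter_upwards [ae_restrict_mem measurableSet_uIoc] with u hu
    rw [uIoc_of_le hs.1] at hu
    have hu' : u ∈ Icc 0 s := ⟨hu.1.le, hu.2⟩
    have h := hstep s hs u hu'
    have h0 : 0 ≤ occRate P F Y k u := (hh0 u ⟨hu'.1, hu'.2.trans hs.2⟩).1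
    have h3 : 0 ≤ (∑' y, F y) * (occRate P F Y k u * q (s - u)) :=
      mul_nonneg hsum (mul_nonneg h0 (hq01 _).1)
    rw [Real.norm_of_nonneg (h3.trans h.1), Real.norm_of_nonneg (h3.trans (h.1.trans h.2))]
    exact h.2
  have hocc : ∀ s ∈ Icc 0 T, occRate P F Y (k + 1) s ∈ Icc
      (((k : ℝ) + 1) * (∑' y, F y) * ∫ u in (0 : ℝ)..s, occRate P F Y k u * q (s - u))
      (((k : ℝ) + 1) * (∑' y, F y) * ∫ u in (0 : ℝ)..s, occRate P F Y k u * p (s - u)) := by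
    intro s hs
    rw [hY.occRate_succ hF hs.1 k, mul_assoc, mul_assoc, ← intervalIntegral.integral_const_mul,
      ← intervalIntegral.integral_const_mul (∑' y, F y)]
    exact ⟨mul_le_mul_of_nonneg_left (intervalIntegral.integral_mono_on hs.1
        ((hprod q hq s hs).const_mul _) (hmid s hs) fun u hu => (hstep s hs u hu).1) hk,
      mul_le_mul_of_nonneg_left (intervalIntegral.integral_mono_on hs.1 (hmid s hs)
        ((hprod p hp s hs).const_mul _) fun u hu => (hstep s hs u hu).2) hk⟩
  have hint := hY.intervalIntegrable_occRate (P := P) hF hT (k + 1)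
  have hks : 0 ≤ ((k : ℝ) + 1) * (∑' y, F y) := mul_nonneg hk hsum
  constructor
  · refine (mul_le_mul_of_nonneg_left q3 hks).trans ?_
    rw [← intervalIntegral.integral_const_mul]
    exact intervalIntegral.integral_mono_on hT (q1.const_mul _) hint fun s hs => (hocc s hs).1
  · refine le_trans ?_ (mul_le_mul_of_nonneg_left p2 hks)
    rw [← intervalIntegral.integral_const_mul]
    exact intervalIntegral.integral_mono_on hT hint (p1.const_mul _) fun s hs => (hocc s hs).2

end Bounds

end IsRegularWalk

/-! ### Asymptotics of the moments -/

/-- A squeeze by induction on `k`: the lower bound differs from the upper by taking `T / 2` and `Q`,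
which costs a factor `(S(T/2)/S(T))^(k+2)` tending to `1`. -/
lemma tendsto_div_pow_of_recursion {I : ℕ → ℝ → ℝ} {G Q S : ℝ → ℝ} {a κ : ℝ}
    (hS : Tendsto S atTop atTop) (hhalf : Tendsto (fun T => S (T / 2) / S T) atTop (𝓝 1))
    (hG : Tendsto (fun T => G T / S T) atTop (𝓝 κ))
    (hQ : Tendsto (fun T => Q T / S T) atTop (𝓝 κ))
    (h0 : ∀ T, 0 ≤ T → I 0 T ∈ Icc (a * Q T) (a * G T))
    (hI : ∀ (k : ℕ) (T : ℝ), 0 ≤ T → I (k + 1) T ∈ Icc (((k : ℝ) + 1) * a * (I k (T / 2) * Q (T / 2)))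
      (((k : ℝ) + 1) * a * (I k T * G T))) (k : ℕ) :
    Tendsto (fun T => I k T / S T ^ (k + 1)) atTop (𝓝 (k.factorial * (a * κ) ^ (k + 1))) := by
  have hdiv : Tendsto (fun T : ℝ => T / 2) atTop atTop :=
    tendsto_id.atTop_div_const (by norm_num)
  have hpos := hS.eventually_gt_atTop 0
  have hpos2 := hdiv.eventually hpos
  induction k with
  | zero =>
    simp only [Nat.factorial_zero, Nat.cast_one, one_mul, zero_add, pow_one]
    refine tendsto_of_tendsto_of_tendsto_of_le_of_le' (hQ.const_mul a) (hG.const_mul a) ?_ ?_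
    · filter_upwards [hpos, eventually_ge_atTop 0] with T hT hT0
      rw [← mul_div_assoc]
      exact div_le_div_of_nonneg_right (h0 T hT0).1 hT.le
    · filter_upwards [hpos, eventually_ge_atTop 0] with T hT hT0
      rw [← mul_div_assoc]
      exact div_le_div_of_nonneg_right (h0 T hT0).2 hT.le
  | succ k ih =>
    have hlow := (((ih.comp hdiv).mul (hQ.comp hdiv)).mul (hhalf.pow (k + 2))).const_mul
      (((k : ℝ) + 1) * a)
    have hupp := (ih.mul hG).const_mul (((k : ℝ) + 1) * a)
    have hlim : ((k : ℝ) + 1) * a * (k.factorial * (a * κ) ^ (k + 1) * κ) =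
        (k + 1).factorial * (a * κ) ^ (k + 1 + 1) := by
      rw [Nat.factorial_succ]
      push_cast
      ring
    rw [one_pow, mul_one, hlim] at hlow
    rw [hlim] at hupp
    refine tendsto_of_tendsto_of_tendsto_of_le_of_le' hlow hupp ?_ ?_
    · filter_upwards [hpos, hpos2, eventually_ge_atTop 0] with T hT hT2 hT0
      refine le_trans (le_of_eq ?_) (div_le_div_of_nonneg_right (hI k T hT0).1 (pow_pos hT _).le)
      simp only [Function.comp]
      have h1 := hT.ne'
      have h2 := hT2.ne'
      rw [div_pow]
      field_simp
      ring
    · filter_upwards [hpos, eventually_ge_atTop 0] with T hT hT0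
      refine (div_le_div_of_nonneg_right (hI k T hT0).2 (pow_pos hT _).le).trans (le_of_eq ?_)
      have h1 := hT.ne'
      field_simp
      ring

lemma le_factorial_mul_pow_of_recursion {I : ℕ → ℝ} {G a : ℝ} (hG : 0 ≤ G) (ha : 0 ≤ a)
    (h0 : I 0 ≤ a * G) (hI : ∀ k, I (k + 1) ≤ ((k : ℝ) + 1) * a * (I k * G)) (k : ℕ) :
    I k ≤ k.factorial * (a * G) ^ (k + 1) := by
  induction k with
  | zero => simpa using h0
  | succ k ih =>
    calc I (k + 1) ≤ ((k : ℝ) + 1) * a * (I k * G) := hI k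
      _ ≤ ((k : ℝ) + 1) * a * (k.factorial * (a * G) ^ (k + 1) * G) := by gcongr
      _ = _ := by
        rw [Nat.factorial_succ]
        push_cast
        ring

namespace IsRegularWalk

variable {D : ℝ} {c : ℕ → ℝ} {x₀ : HierGroup N} {Ω : Type*} [MeasurableSpace Ω]
  {P : Measure Ω} [IsProbabilityMeasure P] {Y : ℝ≥0 → Ω → HierGroup N} {F : HierGroup N → ℝ}
  {K : ℝ} {R : ℕ}

lemma exists_integral_occRate_bounds [NeZero N] (hN : 2 ≤ N) (hc : ∀ j, 0 < c j)
    (hmono : ∀ j, c j ≤ c (j + 1)) (hD : HasSum (fun j : ℕ => radiusProb N D c (j + 1)) 1)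
    (hY : IsRegularWalk (radiusProb N D c) x₀ P Y) (hF : ∀ y, F y ∈ Icc 0 K)
    (hR : ∀ y, F y ≠ 0 → hnorm y ≤ R) (hx₀ : hnorm x₀ ≤ R) :
    ∃ δ > 0, (∀ T, 0 ≤ T → ∫ u in (0 : ℝ)..T, occRate P F Y 0 u ∈
        Icc ((∑' y, F y) * ∫ u in (0 : ℝ)..T, lowerKernel N (radiusProb N D c) δ u)
          ((∑' y, F y) * greenZero N D c T)) ∧
      ∀ (k : ℕ) (T : ℝ), 0 ≤ T → ∫ u in (0 : ℝ)..T, occRate P F Y (k + 1) u ∈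
        Icc (((k : ℝ) + 1) * (∑' y, F y) * ((∫ u in (0 : ℝ)..(T / 2), occRate P F Y k u) *
          ∫ u in (0 : ℝ)..(T / 2), lowerKernel N (radiusProb N D c) δ u))
        (((k : ℝ) + 1) * (∑' y, F y) * ((∫ u in (0 : ℝ)..T, occRate P F Y k u) *
          greenZero N D c T)) := by
  have hr := radiusProb_nonneg hc hD
  obtain ⟨δ, hδ0, hδ⟩ := exists_pos_le_one_sub_eigenVal hN hc hmono hD R
  set r := radiusProb N D c
  -- Freezing the kernels at negative times makes them continuous and bounded on all of `ℝ`.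
  set p : ℝ → ℝ := fun t => transProb r (max t 0) (0 : HierGroup N) with hpdef
  set q : ℝ → ℝ := fun t => lowerKernel N r δ (max t 0) with hqdef
  have hp : Continuous p := (continuousOn_transProb_zero hN hr hD).comp_continuous (by fun_prop)
    fun t => le_max_right t 0
  have hq : Continuous q := (continuousOn_lowerKernel hN hr hD δ).comp_continuous (by fun_prop)
    fun t => le_max_right t 0
  have hp01 : ∀ t, p t ∈ Icc 0 1 := fun t => transProb_zero_mem_Icc hN hr hD (le_max_right t 0)
  have hq01 : ∀ t, q t ∈ Icc 0 1 := fun t => ⟨le_max_left _ _,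
    max_le zero_le_one ((sub_le_self _ (Real.exp_pos _).le).trans (hp01 t).2)⟩
  have hpq : ∀ t, 0 ≤ t → ∀ w : HierGroup N, hnorm w ≤ R →
      transProb r t w ∈ Icc (q t) (p t) := by
    intro t ht w hw
    simp only [hpdef, hqdef, max_eq_left ht]
    refine ⟨max_le ?_ (transProb_zero_sub_le hN hr hD hδ ht hw),
      transProb_le_transProb_zero hN hr hD t w⟩
    -- Nonnegativity of the transition probability is read off from the process itself.
    have := hY.law 0 t.toNNReal w
    rw [Real.coe_toNNReal t ht] at this
    rw [← this]
    exact measureReal_nonneg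
  have hpint : ∀ T, 0 ≤ T → ∫ u in (0 : ℝ)..T, p u = greenZero N D c T := fun T hT => by
    refine intervalIntegral.integral_congr fun u hu => ?_
    rw [uIcc_of_le hT] at hu
    simp only [hpdef, max_eq_left hu.1]
    rfl
  have hqint : ∀ T, 0 ≤ T → ∫ u in (0 : ℝ)..T, q u = ∫ u in (0 : ℝ)..T, lowerKernel N r δ u :=
    fun T hT => by
      refine intervalIntegral.integral_congr fun u hu => ?_
      rw [uIcc_of_le hT] at hu
      simp only [hqdef, max_eq_left hu.1]
  refine ⟨δ, hδ0, fun T hT => ?_, fun k T hT => ?_⟩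
  · have hb : ∀ u ∈ Icc 0 T, occRate P F Y 0 u ∈ Icc (q u * ∑' y, F y) (p u * ∑' y, F y) :=
      fun u hu => hY.occRate_zero_bounds hF hR hx₀ hu.1 (hpq u hu.1)
    rw [← hpint T hT, ← hqint T hT, mul_comm, mul_comm (∑' y, F y),
      ← intervalIntegral.integral_mul_const, ← intervalIntegral.integral_mul_const]
    have hi := hY.intervalIntegrable_occRate (P := P) hF hT 0
    exact ⟨intervalIntegral.integral_mono_on hT ((hq.mul_const _).intervalIntegrable _ _) hi
        fun u hu => (hb u hu).1,
      intervalIntegral.integral_mono_on hT hi ((hp.mul_const _).intervalIntegrable _ _)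
        fun u hu => (hb u hu).2⟩
  · rw [← hpint T hT, ← hqint (T / 2) (by linarith)]
    exact hY.integral_occRate_succ_bounds hF hR hp hq hp01 hq01 hpq hT k

/-- The occupation time of a regular version, normalized, converges to an exponential law. -/
theorem tendsto_measureReal_occTime [NeZero N] (hN : 2 ≤ N) (hc : ∀ j, 0 < c j)
    (hmono : ∀ j, c j ≤ c (j + 1)) (hD : HasSum (fun j : ℕ => radiusProb N D c (j + 1)) 1)
    (hrec : ¬ Summable (fun j : ℕ => (dSeq N c j)⁻¹))
    (hY : IsRegularWalk (radiusProb N D c) x₀ P Y) (hF : ∀ y, F y ∈ Icc 0 K)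
    (hR : ∀ y, F y ≠ 0 → hnorm y ≤ R) (hx₀ : hnorm x₀ ≤ R) (hsum : 0 < ∑' y, F y)
    {x : ℝ} (hx : 0 ≤ x) :
    Tendsto (fun t : ℝ => P.real {ω | (N : ℝ) * D / (((N : ℝ) - 1) * (∑' y, F y) * dSum N c t)
      * occTime F Y t ω < x}) atTop (𝓝 (1 - Real.exp (-x))) := by
  have hN' : (2 : ℝ) ≤ N := by exact_mod_cast hN
  have hD0 := pos_of_hasSum_radiusProb hc hD
  obtain ⟨δ, hδ, hI0, hIs⟩ := hY.exists_integral_occRate_bounds hN hc hmono hD hF hR hx₀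
  have hS := tendsto_dSum hN hc hmono hrec
  have hG := tendsto_greenZero_div_dSum hN hc hmono hD hrec
  set A := ∑' y, F y
  set κ := ((N : ℝ) - 1) / (N * D) with hκ
  have hκ0 : 0 < κ := div_pos (by linarith) (by positivity)
  -- The normalization is the inverse of `A κ dSum`, the asymptotic size of the mean occupation
  -- time.
  have hβ : ∀ t, (N : ℝ) * D / (((N : ℝ) - 1) * A * dSum N c t) = (A * κ * dSum N c t)⁻¹ :=
    fun t => by
      have h1 : (N : ℝ) - 1 ≠ 0 := by linarith
      rw [hκ]
      field_simp
  simp only [hβ]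
  have hlim := tendsto_div_pow_of_recursion (I := fun k T => ∫ u in (0 : ℝ)..T, occRate P F Y k u)
    hS (tendsto_dSum_half hN hc hmono hrec) hG
    (tendsto_integral_lowerKernel_div_dSum hN hc hmono hD hrec hδ) hI0 hIs
  have hmeas : ∀ t, Measurable fun ω => (A * κ * dSum N c t)⁻¹ * occTime F Y t ω := fun t =>
    ((hY.measurable_uncurry_occTime hF).comp measurable_prodMk_left).const_mul _
  have hmom : ∀ (t : ℝ) (k : ℕ), ∫ y : ℝ, y ^ k
      ∂(P.map fun ω => (A * κ * dSum N c t)⁻¹ * occTime F Y t ω) =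
      ((A * κ * dSum N c t)⁻¹) ^ k * ∫ ω, occTime F Y t ω ^ k ∂P := fun t k => by
    rw [integral_map (hmeas t).aemeasurable (Continuous.aestronglyMeasurable (by fun_prop)),
      ← integral_const_mul]
    simp only [mul_pow]
  refine tendsto_of_seq_tendsto fun T hT => ?_
  have hreal : ∀ n, P.real {ω | (A * κ * dSum N c (T n))⁻¹ * occTime F Y (T n) ω < x} =
      (P.map fun ω => (A * κ * dSum N c (T n))⁻¹ * occTime F Y (T n) ω).real (Iio x) := fun n =>
    (map_measureReal_apply (hmeas (T n)) measurableSet_Iio).symm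
  simp only [Function.comp_def, hreal]
  have hprob : ∀ n, IsProbabilityMeasure
      (P.map fun ω => (A * κ * dSum N c (T n))⁻¹ * occTime F Y (T n) ω) := fun n =>
    Measure.isProbabilityMeasure_map (hmeas (T n)).aemeasurable
  refine tendsto_measure_Iio_of_tendsto_moments ?_ (fun k => ?_) hx
  -- Eventually the Green function is below twice its asymptotic value; this is the origin of the `2
  -- ^ k` in `HasExpMoments`.
  · filter_upwards [hT.eventually (hS.eventually_gt_atTop 0), hT.eventually_ge_atTop 0,
      hT.eventually (hG.eventually (gt_mem_nhds (by linarith : κ < 2 * κ)))] with n hSn hTn hGn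
    have hβ0 : 0 < A * κ * dSum N c (T n) := by positivity
    have hG0 : 0 ≤ greenZero N D c (T n) := intervalIntegral.integral_nonneg hTn fun u hu =>
      (transProb_zero_mem_Icc hN (radiusProb_nonneg hc hD) hD hu.1).1
    refine ⟨?_, fun k => ?_, fun k => ?_⟩
    · rw [ae_map_iff (hmeas _).aemeasurable measurableSet_Ici]
      exact ae_of_all _ fun ω => mul_nonneg (inv_nonneg.2 hβ0.le) (hY.occTime_mem_Icc hF hTn ω).1
    · rw [integrable_map_measure (Continuous.aestronglyMeasurable (by fun_prop))
        (hmeas _).aemeasurable]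
      simp only [Function.comp_def, mul_pow]
      exact (hY.integrable_pow_occTime hF hTn k).const_mul _
    · rw [hmom]
      cases k with
      | zero => simp
      | succ k =>
        rw [hY.integral_pow_occTime_succ hF hTn]
        have h1 := le_factorial_mul_pow_of_recursion
          (I := fun k => ∫ u in (0 : ℝ)..(T n), occRate P F Y k u) hG0 hsum.le (hI0 _ hTn).2
          (fun k => (hIs k _ hTn).2) k
        have h2 : (A * κ * dSum N c (T n))⁻¹ * (A * greenZero N D c (T n)) ≤ 2 := by
          rw [div_lt_iff₀ hSn] at hGn
          rw [inv_mul_le_iff₀ hβ0]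
          nlinarith
        calc _ ≤ ((A * κ * dSum N c (T n))⁻¹) ^ (k + 1) * (((k : ℝ) + 1) *
              (k.factorial * (A * greenZero N D c (T n)) ^ (k + 1))) := by gcongr
          _ = (k + 1).factorial *
              ((A * κ * dSum N c (T n))⁻¹ * (A * greenZero N D c (T n))) ^ (k + 1) := by
              rw [Nat.factorial_succ, mul_pow]
              push_cast
              ring
          _ ≤ _ := by gcongr
  · simp only [hmom]
    cases k with
    | zero => simp
    | succ k =>
      have h1 := ((hlim k).comp hT).const_mul ((((A * κ)⁻¹) ^ (k + 1)) * ((k : ℝ) + 1))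
      have h2 : ((A * κ)⁻¹) ^ (k + 1) * ((k : ℝ) + 1) * (k.factorial * (A * κ) ^ (k + 1)) =
          (k + 1).factorial := by
        have : A * κ ≠ 0 := by positivity
        rw [Nat.factorial_succ, inv_pow]
        push_cast
        field_simp
      rw [h2] at h1
      refine h1.congr' ?_
      filter_upwards [hT.eventually_ge_atTop 0] with n hTn
      rw [hY.integral_pow_occTime_succ hF hTn]
      simp only [Function.comp]
      rw [mul_inv (A * κ), mul_pow, div_eq_mul_inv, inv_pow (dSum N c (T n))]
      ring

end IsRegularWalk

end

end HierGroup

/-! ### Transfer from the regular version to the given process. -/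

theorem mainTheorem9 (N : ℕ) (hN : 2 ≤ N) (c : ℕ → ℝ) (hc_pos : ∀ j, 0 < c j)
    (hc_mono : ∀ j, c j ≤ c (j + 1)) (D : ℝ)
    (hD : HasSum (fun j : ℕ => HierGroup.radiusProb N D c (j + 1)) 1)
    (hrec : ¬ Summable (fun j : ℕ => (HierGroup.dSeq N c j)⁻¹))
    {Ω : Type*} [MeasurableSpace Ω] (P : Measure Ω) [IsProbabilityMeasure P]
    (x₀ : HierGroup N) (X : ℝ≥0 → Ω → HierGroup N)
    (hX : HierGroup.IsContinuousTimeWalk (HierGroup.radiusProb N D c) x₀ P X)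
    (F : HierGroup N → ℝ) (hF_nonneg : ∀ y, 0 ≤ F y) (hF_ne : F ≠ 0)
    (hF_supp : ∃ R : ℕ, ∀ y, F y ≠ 0 → HierGroup.hnorm y ≤ R)
    (x : ℝ) (hx : 0 ≤ x) :
    Tendsto
      (fun t : ℝ => P.real {ω |
        (N : ℝ) * D / (((N : ℝ) - 1) * (∑' y, F y) * HierGroup.dSum N c t)
          * (∫ s in (0 : ℝ)..t, F (X s.toNNReal ω)) < x})
      atTop (𝓝 (1 - Real.exp (-x))) := by
  have : NeZero N := ⟨by omega⟩
  obtain ⟨R₀, hR₀⟩ := hF_supp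
  -- The radius is enlarged so that the ball also contains the starting point.
  have hR : ∀ y, F y ≠ 0 → HierGroup.hnorm y ≤ max R₀ (HierGroup.hnorm x₀) := fun y hy =>
    (hR₀ y hy).trans (le_max_left _ _)
  have htsum := HierGroup.IsRegularWalk.tsum_eq_sum_ball hR
  have hle : ∀ y, F y ≤ ∑' y, F y := fun y => by
    by_cases hy : F y = 0
    · rw [hy]
      exact tsum_nonneg hF_nonneg
    · rw [htsum]
      exact Finset.single_le_sum (fun z _ => hF_nonneg z) (HierGroup.mem_ball.2 (hR y hy))
  have hsum : 0 < ∑' y, F y := by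
    obtain ⟨y, hy⟩ := Function.ne_iff.1 hF_ne
    exact ((hF_nonneg y).lt_of_ne (Ne.symm hy)).trans_le (hle y)
  obtain ⟨Y, hY, hXY⟩ := hX.exists_isRegularWalk
  refine (hY.tendsto_measureReal_occTime hN hc_pos hc_mono hD hrec
    (fun y => ⟨hF_nonneg y, hle y⟩) hR (le_max_right _ _) hsum hx).congr fun t => ?_
  refine measureReal_congr (eventuallyEq_set.2 ?_)
  filter_upwards [hXY] with ω hω
  simp only [HierGroup.occTime, ← hω]
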